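/- Let $(A,\alpha)$ and $(B,\beta)$ be unital $\mathbb{Z}_2$-graded $C^*$-algebras, i.e. unital $C^*$-algebras with $*$-automorphisms $\alpha,\beta$ satisfying $\alpha^2=\mathrm{id}$, $\beta^2=\mathrm{id}$, and suppose that $\alpha=\mathrm{ad}_u$ (that is, $\alpha(a)=uau^*$) for some selfadjoint unitary $u\in A$. For $b\in B$ put $b_\pm=\tfrac12(b\pm\beta(b))$. A functional is called even if it is invariant under the grading. For an even state $\omega$ on $(A,\alpha)$ let $(H_\omega,\pi_\omega,\xi_\omega)$ be its GNS representation and $V_\omega$ the unitary on $H_\omega$ with $V_\omega\pi_\omega(a)\xi_\omega=\pi_\omega(\alpha(a))\xi_\omega$ (similarly for $B$). The minimal $C^*$-tensor product $A\otimes B$ is the completion of the algebraic tensor product in the norm $\sup_{\omega,\varphi}\|(\pi_\omega\otimes\pi_\varphi)(\cdot)\|$ over all states $\omega$ of $A$ and $\varphi$ of $B$. The minimal $C^*$-Fermi tensor product $A\circledast B$ is the completion of the algebraic Fermi tensor product, spanned by elementary tensors $a\circledast b$, in the norm $\sup_{\omega,\varphi}\|\pi_{\omega\times\varphi}(\cdot)\|$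 over all even states $\omega$ of $A$ and $\varphi$ of $B$, where $\pi_{\omega\times\varphi}$ is the representation on $H_\omega\otimes H_\varphi$ given by $$\pi_{\omega\times\varphi}(a\circledast b)=\pi_\omega(a)\otimes\pi_\varphi(b_+)+\pi_\omega(a)V_\omega\otimes\pi_\varphi(b_-).$$ A product state on $A\otimes B$ (resp. on $A\circledast B$) is a state $\psi$ such that, for some states $\omega$ of $A$ and $\varphi$ of $B$, $\psi(a\otimes b)=\omega(a)\varphi(b)$ (resp. $\psi(a\circledast b)=\omega(a)\varphi(b)$) for all $a,b$. Then: 1. There are unique $*$-automorphisms $\alpha\circledast\beta$ of $A\circledast B$ and $\alpha\otimes\beta$ of $A\otimes B$ with $(\alpha\circledast\beta)(a\circledast b)=\alpha(a)\circledast\beta(b)$ and $(\alpha\otimes\beta)(a\otimes b)=\alpha(a)\otimes\beta(b)$; evenness on $A\circledast B$ and on $A\otimes B$ refers to these gradings. 2. There is a unique $*$-isomorphism $\kappa:A\circledast B\to A\otimes B$ (the Klein transformation) with $$\kappa(a\circledast b)=a\otimes b_+ + au\otimes b_-\qquad(a\in A,\ b\in B),$$ and it is grading-equivariant: $\kappa\circ(\alpha\circledast\beta)=(\alpha\otimes\beta)\circ\kappa$.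 3. For all even states $\omega$ of $A$ and $\varphi$ of $B$ there are a unique product state $\psi_{\omega,\varphi}$ on $A\otimes B$ with $\psi_{\omega,\varphi}(a\otimes b)=\omega(a)\varphi(b)$ and a unique product state $\omega\times\varphi$ on $A\circledast B$ with $(\omega\times\varphi)(a\circledast b)=\omega(a)\varphi(b)$, and $\psi_{\omega,\varphi}\circ\kappa=\omega\times\varphi$. 4. The transpose $\psi\mapsto\psi\circ\kappa$ is a bijection from the set of even product states on $A\otimes B$ onto the set of even product states on $A\circledast B$. -/

import Mathlib

open scoped TensorProduct ENNReal ComplexOrder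

noncomputable section

namespace KleinFermi

/-! ### States and even states -/

section States

variable {C : Type*} [Ring C] [StarRing C] [Algebra ℂ C]

/-- A linear functional on a unital `*`-algebra is a state if it is unital and positive. -/
structure IsState (ψ : C →ₗ[ℂ] ℂ) : Prop where
  map_one : ψ 1 = 1
  nonneg : ∀ x, 0 ≤ ψ (star x * x)

/-- A functional is even with respect to `θ` if it is `θ`-invariant. -/
def IsEven (θ : C ≃⋆ₐ[ℂ] C) (ψ : C →ₗ[ℂ] ℂ) : Prop :=
  ∀ x, ψ (θ x) = ψ x

/-- Even part `b₊ = (b + θ b) / 2`. -/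
def evenPart (θ : C ≃⋆ₐ[ℂ] C) (b : C) : C := (2⁻¹ : ℂ) • (b + θ b)

/-- Odd part `b₋ = (b - θ b) / 2`. -/
def oddPart (θ : C ≃⋆ₐ[ℂ] C) (b : C) : C := (2⁻¹ : ℂ) • (b - θ b)

variable (C) in
/-- The state space of `C`. -/
def States : Type _ := {ω : C →ₗ[ℂ] ℂ // IsState ω}

/-- The space of even states of `(C, θ)`. -/
def EvenStates (θ : C ≃⋆ₐ[ℂ] C) : Type _ := {ω : States C // IsEven θ ω.1}

end States

/-! ### GNS representations -/

section GNS

variable {A : Type*} [CStarAlgebra A] [PartialOrder A] [StarOrderedRing A]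

/-- A state as one of Mathlib's positive linear functionals. -/
def States.toPositive (ω : States A) : A →ₚ[ℂ] ℂ :=
  PositiveLinearMap.mk₀ ω.1 fun x hx => by
    obtain ⟨y, rfl⟩ := CStarAlgebra.nonneg_iff_eq_star_mul_self.mp hx
    exact ω.2.nonneg y

theorem States.toPositive_apply (ω : States A) (a : A) : ω.toPositive a = ω.1 a := rfl

/-- The GNS Hilbert space of a state. -/
abbrev States.H (ω : States A) : Type _ := ω.toPositive.GNS

/-- The GNS representation of a state. -/
abbrev States.rep (ω : States A) : A →⋆ₐ[ℂ] (ω.H →L[ℂ] ω.H) := ω.toPositive.gnsStarAlgHom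

instance States.nontrivial_H (ω : States A) : Nontrivial ω.H := by
  refine ⟨⟨((ω.toPositive.toPreGNS 1 : ω.toPositive.PreGNS) : ω.H), 0, fun h => ?_⟩⟩
  have h1 := congrArg (fun x : ω.H => ‖x‖) h
  simp only [UniformSpace.Completion.norm_coe, norm_zero] at h1
  have h2 := ω.toPositive.preGNS_norm_sq (ω.toPositive.toPreGNS 1)
  rw [h1] at h2
  simp [States.toPositive_apply, ω.2.map_one] at h2

/-- For an even state `ω` of `(A, α)`, the covariance unitary `V_ω` on the GNS space, determined by
`V_ω π_ω(a) ξ_ω = π_ω(α a) ξ_ω`. -/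
def EvenStates.V {α : A ≃⋆ₐ[ℂ] A} (ω : EvenStates α) : ω.1.H →L[ℂ] ω.1.H :=
  ContinuousLinearMap.completion <|
    LinearMap.mkContinuous
      (ω.1.toPositive.toPreGNS.toLinearMap ∘ₗ α.toAlgEquiv.toLinearMap ∘ₗ
        ω.1.toPositive.ofPreGNS.toLinearMap) 1 fun x => by
      have h : ω.1.toPositive (star (α (ω.1.toPositive.ofPreGNS x)) *
          α (ω.1.toPositive.ofPreGNS x)) =
          ω.1.toPositive (star (ω.1.toPositive.ofPreGNS x) * ω.1.toPositive.ofPreGNS x) := by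
        rw [← map_star, ← map_mul]
        exact ω.2 _
      rw [PositiveLinearMap.preGNS_norm_def, PositiveLinearMap.preGNS_norm_def, one_mul]
      exact le_of_eq (congrArg (fun z : ℂ => √z.re) h)

end GNS

/-! ### Hilbert tensor product, usual and Fermi products of operators -/

section Operators

variable (E F : Type*) [NormedAddCommGroup E] [InnerProductSpace ℂ E]
  [NormedAddCommGroup F] [InnerProductSpace ℂ F]

/-- The Hilbert space tensor product. -/
abbrev HTensor : Type _ := UniformSpace.Completion (E ⊗[ℂ] F)

instance HTensor.nontrivial [Nontrivial E] [Nontrivial F] : Nontrivial (HTensor E F) := by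
  obtain ⟨x, hx⟩ := exists_ne (0 : E)
  obtain ⟨y, hy⟩ := exists_ne (0 : F)
  refine ⟨⟨((x ⊗ₜ[ℂ] y : E ⊗[ℂ] F) : HTensor E F), 0, fun h => ?_⟩⟩
  have h1 := congrArg (fun z : HTensor E F => ‖z‖) h
  simp [UniformSpace.Completion.norm_coe, hx, hy] at h1

variable {E F}

/-- The tensor product `S ⊗ T` of bounded operators, `(S ⊗ T)(ξ ⊗ η) = Sξ ⊗ Tη`. -/
def opTensor (S : E →L[ℂ] E) (T : F →L[ℂ] F) : HTensor E F →L[ℂ] HTensor E F :=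
  (TensorProduct.mapL S T).completion

/-- The Fermi product of bounded operators on the Hilbert spaces `E`, `F` graded by selfadjoint
unitaries `V`, `W`. With `T± = (T ± W T W) / 2`, it is `S ⊗ T₊ + S V ⊗ T₋`, that is,
`ξ ⊗ η ↦ ε(T, ξ) Sξ ⊗ Tη` for `T` and `ξ` homogeneous, where `ε(T, ξ)` is `-1` if `T` and `ξ` are
both odd, and `1` otherwise. -/
def opFermi (V : E →L[ℂ] E) (W : F →L[ℂ] F) (S : E →L[ℂ] E) (T : F →L[ℂ] F) :
    HTensor E F →L[ℂ] HTensor E F :=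
  opTensor S ((2⁻¹ : ℂ) • (T + W * T * W)) + opTensor (S * V) ((2⁻¹ : ℂ) • (T - W * T * W))

theorem norm_completion_le {G : Type*} [SeminormedAddCommGroup G] [NormedSpace ℂ G]
    (f : G →L[ℂ] G) : ‖f.completion‖ ≤ ‖f‖ := by
  refine ContinuousLinearMap.opNorm_le_bound _ (norm_nonneg _) fun x => ?_
  induction x using UniformSpace.Completion.induction_on with
  | hp => apply isClosed_le <;> fun_prop
  | ih x => simpa using f.le_opNorm x

theorem norm_opTensor_le (S : E →L[ℂ] E) (T : F →L[ℂ] F) : ‖opTensor S T‖ ≤ ‖S‖ * ‖T‖ :=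
  (norm_completion_le _).trans (TensorProduct.norm_mapL_le S T)

theorem norm_opFermi_le {V : E →L[ℂ] E} {W : F →L[ℂ] F} (hV : ‖V‖ ≤ 1) (hW : ‖W‖ ≤ 1)
    (S : E →L[ℂ] E) (T : F →L[ℂ] F) : ‖opFermi V W S T‖ ≤ 2 * (‖S‖ * ‖T‖) := by
  have h1 : ‖W * T * W‖ ≤ ‖T‖ :=
    calc ‖W * T * W‖ ≤ ‖W‖ * ‖T‖ * ‖W‖ := norm_mul₃_le
      _ ≤ 1 * ‖T‖ * 1 := by gcongr
      _ = ‖T‖ := by ring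
  have h2 : ‖(2⁻¹ : ℂ) • (T + W * T * W)‖ ≤ ‖T‖ := by
    rw [norm_smul]
    have := norm_add_le T (W * T * W)
    norm_num
    linarith
  have h3 : ‖(2⁻¹ : ℂ) • (T - W * T * W)‖ ≤ ‖T‖ := by
    rw [norm_smul]
    have := norm_sub_le T (W * T * W)
    norm_num
    linarith
  have h4 : ‖S * V‖ ≤ ‖S‖ :=
    calc ‖S * V‖ ≤ ‖S‖ * ‖V‖ := norm_mul_le _ _
      _ ≤ ‖S‖ * 1 := by gcongr
      _ = ‖S‖ := by ring
  refine (norm_add_le (opTensor S _) (opTensor (S * V) _)).trans ?_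
  rw [two_mul]
  refine add_le_add ((norm_opTensor_le _ _).trans ?_) ((norm_opTensor_le _ _).trans ?_)
  · gcongr
  · gcongr

end Operators

section Families

variable {I : Type*} (K : I → Type*) [∀ i, NormedAddCommGroup (K i)]
  [∀ i, InnerProductSpace ℂ (K i)] [∀ i, CompleteSpace (K i)] [∀ i, Nontrivial (K i)]

/-- The product `C*`-algebra `∏ᵢ B(Kᵢ)` of all bounded families of operators on the Hilbert spaces
`Kᵢ`, with the supremum norm. -/
abbrev OpFamily : Type _ := lp (fun i => K i →L[ℂ] K i) ∞

instance OpFamily.instCStarAlgebra : CStarAlgebra (OpFamily K) where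

/-- The `C*`-subalgebra generated by a subset of a unital `C*`-algebra. -/
def closedAdjoin {X : Type*} [CStarAlgebra X] (S : Set X) : StarSubalgebra ℂ X :=
  (StarAlgebra.adjoin ℂ S).topologicalClosure

theorem subset_closedAdjoin {X : Type*} [CStarAlgebra X] (S : Set X) :
    S ⊆ closedAdjoin S :=
  (StarAlgebra.subset_adjoin ℂ S).trans (StarSubalgebra.le_topologicalClosure _)

instance closedAdjoin.instCStarAlgebra {X : Type*} [CStarAlgebra X] (S : Set X) :
    CStarAlgebra (closedAdjoin S) :=
  StarSubalgebra.cstarAlgebra _ (h_closed := StarSubalgebra.isClosed_topologicalClosure _)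

end Families

/-! ### The minimal tensor product and the minimal Fermi tensor product -/

section Products

variable {A B : Type*} [CStarAlgebra A] [PartialOrder A] [StarOrderedRing A]
  [CStarAlgebra B] [PartialOrder B] [StarOrderedRing B]

theorem norm_rep_le (ω : States A) (a : A) : ‖ω.rep a‖ ≤ ‖a‖ :=
  NonUnitalStarAlgHom.norm_apply_le ω.rep a

theorem EvenStates.norm_V_le {α : A ≃⋆ₐ[ℂ] A} (ω : EvenStates α) : ‖ω.V‖ ≤ 1 :=
  (norm_completion_le _).trans (LinearMap.mkContinuous_norm_le _ zero_le_one _)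

variable (A B) in
/-- The `C*`-algebra of bounded families of operators on the spaces `H_ω ⊗ H_φ`, for `ω` a state
of `A` and `φ` a state of `B`. -/
abbrev Ambient : Type _ :=
  OpFamily fun p : States A × States B => HTensor p.1.H p.2.H

/-- The image `(π_ω(a) ⊗ π_φ(b))_{ω,φ}` of `a ⊗ b` in the product of the representations
`π_ω ⊗ π_φ` over all pairs of states. -/
def ambientTmul (a : A) (b : B) : Ambient A B :=
  ⟨fun p => opTensor (p.1.rep a) (p.2.rep b), memℓp_infty ⟨‖a‖ * ‖b‖, by
    rintro _ ⟨p, rfl⟩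
    refine (norm_opTensor_le _ _).trans ?_
    gcongr
    · exact norm_rep_le p.1 a
    · exact norm_rep_le p.2 b⟩⟩

variable (A B) in
/-- The minimal (spatial) `C*`-tensor product: the closure of the image of the algebraic tensor
product, i.e. its completion in the norm `‖x‖ = sup ‖(π_ω ⊗ π_φ)(x)‖` over all pairs of states. -/
def MinTensor : Type _ :=
  closedAdjoin {x : Ambient A B | ∃ a b, x = ambientTmul a b}

instance MinTensor.instCStarAlgebra : CStarAlgebra (MinTensor A B) :=
  closedAdjoin.instCStarAlgebra _

/-- The elementary tensor `a ⊗ b`. -/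
def tmul (a : A) (b : B) : MinTensor A B :=
  ⟨ambientTmul a b, subset_closedAdjoin _ ⟨a, b, rfl⟩⟩

variable (α : A ≃⋆ₐ[ℂ] A) (β : B ≃⋆ₐ[ℂ] B)

/-- The `C*`-algebra of bounded families of operators on the spaces `H_ω ⊗ H_φ`, for `ω` an even
state of `(A, α)` and `φ` an even state of `(B, β)`. -/
abbrev FermiAmbient : Type _ :=
  OpFamily fun p : EvenStates α × EvenStates β => HTensor p.1.1.H p.2.1.H

/-- The image of the elementary Fermi tensor of `a` and `b` in the product, over all pairs of even
states, of the GNS representations of the product states `ω × φ`: the latter act on `H_ω ⊗ H_φ`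
(with the grading unitaries `V_ω`, `V_φ`) by the Fermi products of `π_ω(a)` and `π_φ(b)`. -/
def ambientFmul (a : A) (b : B) : FermiAmbient α β :=
  ⟨fun p => opFermi p.1.V p.2.V (p.1.1.rep a) (p.2.1.rep b), memℓp_infty ⟨2 * (‖a‖ * ‖b‖), by
    rintro _ ⟨p, rfl⟩
    refine (norm_opFermi_le p.1.norm_V_le p.2.norm_V_le _ _).trans ?_
    gcongr
    · exact norm_rep_le p.1.1 a
    · exact norm_rep_le p.2.1 b⟩⟩

/-- The minimal `C*`-Fermi tensor product of `(A, α)` and `(B, β)`: the closure of the image of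
the algebraic Fermi tensor product, i.e. its completion in the norm `‖x‖ = sup ‖π_{ω × φ}(x)‖`
over all pairs of even states. -/
def FermiTensor : Type _ :=
  closedAdjoin {x : FermiAmbient α β | ∃ a b, x = ambientFmul α β a b}

instance FermiTensor.instCStarAlgebra : CStarAlgebra (FermiTensor α β) :=
  closedAdjoin.instCStarAlgebra _

/-- The elementary Fermi tensor of `a` and `b`. -/
def fmul (a : A) (b : B) : FermiTensor α β :=
  ⟨ambientFmul α β a b, subset_closedAdjoin _ ⟨a, b, rfl⟩⟩

end Products

/-! ### Product gradings, product states, Klein transformation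

These notions make sense for any map `m : A → B → C` playing the role of the elementary tensors, and are
used for `tmul` and for `fmul α β`. -/

section Product

variable {A B C : Type*} [Ring A] [StarRing A] [Algebra ℂ A] [Ring B] [StarRing B] [Algebra ℂ B]
  [Ring C] [StarRing C] [Algebra ℂ C]

/-- `θ` is the product of the gradings `α` and `β`. -/
def IsProductGrading (m : A → B → C) (α : A ≃⋆ₐ[ℂ] A) (β : B ≃⋆ₐ[ℂ] B)
    (θ : C ≃⋆ₐ[ℂ] C) : Prop :=
  ∀ a b, θ (m a b) = m (α a) (β b)

/-- `ψ` is the product state of the states `ω` and `φ`. -/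
structure IsProductStateOf (m : A → B → C) (ω : A →ₗ[ℂ] ℂ) (φ : B →ₗ[ℂ] ℂ)
    (ψ : C →ₗ[ℂ] ℂ) : Prop where
  left : IsState ω
  right : IsState φ
  isState : IsState ψ
  map_elem : ∀ a b, ψ (m a b) = ω a * φ b

/-- The product states that are even with respect to the grading `θ`. -/
def evenProductStates (m : A → B → C) (θ : C ≃⋆ₐ[ℂ] C) : Set (C →ₗ[ℂ] ℂ) :=
  {ψ | IsEven θ ψ ∧ ∃ ω φ, IsProductStateOf m ω φ ψ}

end Product

section Klein

variable {A B : Type*} [CStarAlgebra A] [PartialOrder A] [StarOrderedRing A]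
  [CStarAlgebra B] [PartialOrder B] [StarOrderedRing B]

/-- `κ` is the Klein transformation: it maps the elementary Fermi tensor of `a` and `b` to
`a ⊗ b₊ + a u ⊗ b₋`. Equivalently, it maps the elementary Fermi tensor of `a` and `1` to `a ⊗ 1`,
and the sum of those of `1` and `b₊` and of `u` and `b₋` to `1 ⊗ b`. -/
def IsKlein (α : A ≃⋆ₐ[ℂ] A) (β : B ≃⋆ₐ[ℂ] B) (u : A)
    (κ : FermiTensor α β ≃⋆ₐ[ℂ] MinTensor A B) : Prop :=
  ∀ a b, κ (fmul α β a b) = tmul a (evenPart β b) + tmul (a * u) (oddPart β b)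

/-- The transpose `ψ ↦ ψ ∘ κ`. -/
def transpose {C D : Type*} [Ring C] [StarRing C] [Algebra ℂ C] [Ring D] [StarRing D]
    [Algebra ℂ D] (κ : C ≃⋆ₐ[ℂ] D) (ψ : D →ₗ[ℂ] ℂ) : C →ₗ[ℂ] ℂ :=
  ψ ∘ₗ κ.toAlgEquiv.toLinearMap

end Klein

end KleinFermi

end

open scoped TensorProduct ENNReal ComplexOrder

noncomputable section

namespace KleinFermi

/-! ### Operators on the Hilbert tensor product -/

section Operators

variable {E F G : Type*} [NormedAddCommGroup E] [InnerProductSpace ℂ E]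
  [NormedAddCommGroup F] [InnerProductSpace ℂ F]

/-! Both products can be realised in one `C*`-algebra, the bounded families of operators on `H_ω ⊗
H_φ` over pairs of even states, and there they are unitarily conjugate.

For `A ⊗ B` this requires that even states suffice for the norm. A state `ω` is dominated by twice
its average `(ω + ω ∘ α) / 2`, so the GNS space of the average maps boundedly onto the cyclic
vectors of `ω`. Hence the kernel of `π ⊗ π` at the averaged pair lies in the kernel at the original
pair, and restriction to even pairs is injective (`restrict_incl_injective`).

Since `u` and `V_ω` both implement `α`, the involution `j = π_ω(u) V_ω ⊗ 1` commutes with every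
`π_ω(a) ⊗ π_φ(b)`, whereas `w = 1 ⊗ V_φ` commutes or anticommutes with it according to the parity of
`b`. The unitary equal to `1` where `j = 1` and to `w` where `j = -1` therefore fixes `a ⊗ b₊` and
multiplies `a u ⊗ b₋` by `j`, which turns it into `a V_ω ⊗ b₋` (`IsGradedTensor.kleinUnitary_conj`).
Conjugation by it carries the image of `A ⊗ B` onto the Fermi product, and its inverse is `κ`. A
further conjugation by `V_ω ⊗ V_φ` gives the product grading.

For states, an even `φ` vanishes on `b₋`, so the factor `u` is invisible and `ψ ∘ κ` has the same
marginals as `ψ`. Uniqueness throughout is density of the span of elementary tensors together with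
automatic continuity. -/

theorem HTensor.ext_continuousLinearMap [NormedAddCommGroup G] [NormedSpace ℂ G]
    {f g : HTensor E F →L[ℂ] G}
    (h : ∀ x y, f ((x ⊗ₜ[ℂ] y : E ⊗[ℂ] F) : HTensor E F) =
      g ((x ⊗ₜ[ℂ] y : E ⊗[ℂ] F) : HTensor E F)) : f = g := by
  ext z
  induction z using UniformSpace.Completion.induction_on with
  | hp => apply isClosed_eq <;> fun_prop
  | ih z =>
    induction z using TensorProduct.induction_on with
    | zero => simp [UniformSpace.Completion.coe_zero]
    | tmul x y => exact h x y
    | add x y hx hy => simp only [UniformSpace.Completion.coe_add, map_add, hx, hy]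

@[simp]
theorem opTensor_coe_tmul (S : E →L[ℂ] E) (T : F →L[ℂ] F) (x : E) (y : F) :
    opTensor S T ((x ⊗ₜ[ℂ] y : E ⊗[ℂ] F) : HTensor E F) =
      ((S x ⊗ₜ[ℂ] T y : E ⊗[ℂ] F) : HTensor E F) := by
  simp [opTensor]

theorem opTensor_mul (S S' : E →L[ℂ] E) (T T' : F →L[ℂ] F) :
    opTensor S T * opTensor S' T' = opTensor (S * S') (T * T') :=
  HTensor.ext_continuousLinearMap fun x y => by simp

theorem opTensor_one : opTensor (1 : E →L[ℂ] E) (1 : F →L[ℂ] F) = 1 :=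
  HTensor.ext_continuousLinearMap fun x y => by simp

theorem opTensor_add_right (S : E →L[ℂ] E) (T T' : F →L[ℂ] F) :
    opTensor S (T + T') = opTensor S T + opTensor S T' :=
  HTensor.ext_continuousLinearMap fun x y => by
    simp [TensorProduct.tmul_add, UniformSpace.Completion.coe_add]

theorem star_opTensor [CompleteSpace E] [CompleteSpace F] (S : E →L[ℂ] E) (T : F →L[ℂ] F) :
    star (opTensor S T) = opTensor (star S) (star T) := by
  refine ((ContinuousLinearMap.eq_adjoint_iff _ _).mpr fun x y => ?_).symm
  induction x, y using UniformSpace.Completion.induction_on₂ with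
  | hp => apply isClosed_eq <;> fun_prop
  | ih x y =>
    induction x using TensorProduct.induction_on with
    | zero => simp [UniformSpace.Completion.coe_zero]
    | add x x' hx hx' =>
      simp only [UniformSpace.Completion.coe_add, map_add, inner_add_left, hx, hx']
    | tmul x x' =>
      induction y using TensorProduct.induction_on with
      | zero => simp [UniformSpace.Completion.coe_zero]
      | add x x' hx hx' =>
        simp only [UniformSpace.Completion.coe_add, map_add, inner_add_right, hx, hx']
      | tmul y y' =>
        simp [ContinuousLinearMap.star_eq_adjoint, ContinuousLinearMap.adjoint_inner_left]

end Operators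

/-! ### Cyclic vectors and the grading unitary of an even state -/

section GNS

variable {A : Type*} [CStarAlgebra A] [PartialOrder A] [StarOrderedRing A]

/-- The vector `π_ω(a) ξ_ω` of the GNS space. -/
def States.vec (ω : States A) (a : A) : ω.H :=
  ((ω.toPositive.toPreGNS a : ω.toPositive.PreGNS) : ω.H)

theorem States.rep_vec (ω : States A) (a c : A) : ω.rep a (ω.vec c) = ω.vec (a * c) := by
  simp [States.vec]

theorem States.inner_vec (ω : States A) (a c : A) :
    inner ℂ (ω.vec a) (ω.vec c) = ω.1 (star a * c) := by
  simp [States.vec, PositiveLinearMap.preGNS_inner_def, States.toPositive_apply]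

theorem States.denseRange_vec (ω : States A) : DenseRange ω.vec :=
  UniformSpace.Completion.denseRange_coe.comp ω.toPositive.toPreGNS.surjective.denseRange
    (UniformSpace.Completion.continuous_coe _)

theorem States.ext_continuousLinearMap (ω : States A) {G : Type*} [NormedAddCommGroup G]
    [NormedSpace ℂ G] {f g : ω.H →L[ℂ] G} (h : ∀ a, f (ω.vec a) = g (ω.vec a)) : f = g :=
  DFunLike.coe_injective (ω.denseRange_vec.equalizer f.continuous g.continuous (funext h))

variable {α : A ≃⋆ₐ[ℂ] A}

theorem EvenStates.V_vec (ω : EvenStates α) (a : A) : ω.V (ω.1.vec a) = ω.1.vec (α a) := by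
  simp [EvenStates.V, States.vec]

theorem EvenStates.V_mul_V (hα : ∀ a, α (α a) = a) (ω : EvenStates α) : ω.V * ω.V = 1 :=
  ω.1.ext_continuousLinearMap fun a => by simp [EvenStates.V_vec, hα]

theorem EvenStates.V_mul_rep (ω : EvenStates α) (a : A) :
    ω.V * ω.1.rep a = ω.1.rep (α a) * ω.V :=
  ω.1.ext_continuousLinearMap fun c => by
    simp only [mul_apply_eq_comp, States.rep_vec, EvenStates.V_vec, map_mul]

/-- On cyclic vectors, invariance of `ω` under `α` and `α² = 1` move `α` from one side of the inner
product to the other. -/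
theorem EvenStates.star_V (hα : ∀ a, α (α a) = a) (ω : EvenStates α) : star ω.V = ω.V := by
  refine ((ContinuousLinearMap.eq_adjoint_iff _ _).mpr fun x y => ?_).symm
  refine ω.1.denseRange_vec.induction_on₂ (p := fun x y => inner ℂ (ω.V x) y = inner ℂ x (ω.V y))
    ?_ (fun a c => ?_) x y
  · apply isClosed_eq <;> fun_prop
  · rw [EvenStates.V_vec, EvenStates.V_vec, States.inner_vec, States.inner_vec, ← ω.2, map_mul,
      map_star, hα]

end GNS

/-! ### Conjugation by the twist of two commuting involutions -/

section Conjugation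

variable {R : Type*} [Ring R] [Algebra ℂ R]

/-- For commuting involutions `j` and `w`, the involution `(1 + j) / 2 + w (1 - j) / 2`. -/
def twist (j w : R) : R := (2⁻¹ : ℂ) • (1 + j + w - j * w)

variable {j w x : R}

/-- The twist is a polynomial in `j` and `w`, so it commutes with `x`; being `1` where `j = 1` and
`w` where `j = -1`, it squares to `1`. -/
theorem twist_mul_mul_twist_of_commute (hj : j * j = 1) (hw : w * w = 1)
    (hjw : w * j = j * w) (hjx : j * x = x * j) (hwx : w * x = x * w) :
    twist j w * x * twist j w = x := by
  have hj' (y : R) : j * (j * y) = y := by rw [← mul_assoc, hj, one_mul]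
  have hjw' (y : R) : w * (j * y) = j * (w * y) := by rw [← mul_assoc, hjw, mul_assoc]
  have hjx' (y : R) : j * (x * y) = x * (j * y) := by rw [← mul_assoc, hjx, mul_assoc]
  simp only [twist, smul_mul_assoc, mul_smul_comm, mul_add, add_mul, mul_sub, sub_mul, mul_assoc,
    hj, hw, hjw, hjx, hwx, hj', hjw', hjx', one_mul, mul_one]
  module

/-- Since `x` preserves the eigenspaces of `j`, conjugation gives `x` where `j = 1` and `w x w = -x`
where `j = -1`. The sign is exactly `j`. -/
theorem twist_mul_mul_twist_of_anticommute (hj : j * j = 1) (hw : w * w = 1)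
    (hjw : w * j = j * w) (hjx : j * x = x * j) (hwx : w * x = -(x * w)) :
    twist j w * x * twist j w = x * j := by
  have hj' (y : R) : j * (j * y) = y := by rw [← mul_assoc, hj, one_mul]
  have hjw' (y : R) : w * (j * y) = j * (w * y) := by rw [← mul_assoc, hjw, mul_assoc]
  have hjx' (y : R) : j * (x * y) = x * (j * y) := by rw [← mul_assoc, hjx, mul_assoc]
  simp only [twist, smul_mul_assoc, mul_smul_comm, mul_add, add_mul, mul_sub, sub_mul, mul_assoc,
    hj, hw, hjw, hjx, hwx, hj', hjw', hjx', one_mul, mul_one, mul_neg, neg_mul]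
  module

theorem twist_mul_twist (hj : j * j = 1) (hw : w * w = 1) (hjw : w * j = j * w) :
    twist j w * twist j w = 1 := by
  simpa using twist_mul_mul_twist_of_commute (x := 1) hj hw hjw (by simp) (by simp)

theorem star_twist {R : Type*} [Ring R] [StarRing R] [Algebra ℂ R] [StarModule ℂ R] {j w : R}
    (hj : star j = j) (hw : star w = w) (hjw : w * j = j * w) : star (twist j w) = twist j w := by
  simp [twist, hj, hw, hjw]

end Conjugation

/-! ### Even and odd parts -/

section Grading

variable {C : Type*} [Ring C] [StarRing C] [Algebra ℂ C] {θ : C ≃⋆ₐ[ℂ] C}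

theorem evenPart_add_oddPart (b : C) : evenPart θ b + oddPart θ b = b := by
  simp only [evenPart, oddPart]; module

theorem evenPart_map (b : C) : evenPart θ (θ b) = θ (evenPart θ b) := by
  simp [evenPart]

theorem oddPart_map (b : C) : oddPart θ (θ b) = θ (oddPart θ b) := by
  simp [oddPart]

theorem IsEven.map_oddPart {ψ : C →ₗ[ℂ] ℂ} (h : IsEven θ ψ) (b : C) : ψ (oddPart θ b) = 0 := by
  simp [oddPart, h b]

theorem map_evenPart (hθ : ∀ b, θ (θ b) = b) (b : C) :
    θ (evenPart θ b) = evenPart θ b := by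
  simp [evenPart, hθ, add_comm]

theorem map_oddPart (hθ : ∀ b, θ (θ b) = b) (b : C) :
    θ (oddPart θ b) = -oddPart θ b := by
  simp [oddPart, hθ, ← smul_neg]

theorem evenPart_evenPart (hθ : ∀ b, θ (θ b) = b) (b : C) :
    evenPart θ (evenPart θ b) = evenPart θ b := by
  rw [evenPart, map_evenPart hθ]; module

theorem oddPart_evenPart (hθ : ∀ b, θ (θ b) = b) (b : C) :
    oddPart θ (evenPart θ b) = 0 := by
  rw [oddPart, map_evenPart hθ]; module

theorem evenPart_oddPart (hθ : ∀ b, θ (θ b) = b) (b : C) :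
    evenPart θ (oddPart θ b) = 0 := by
  rw [evenPart, map_oddPart hθ]; module

theorem oddPart_oddPart (hθ : ∀ b, θ (θ b) = b) (b : C) :
    oddPart θ (oddPart θ b) = oddPart θ b := by
  rw [oddPart, map_oddPart hθ]; module

end Grading

/-- Closure under products and adjoints passes from `S` to its span, which is thus already a
`*`-subalgebra. This makes elementary tensors determine merely linear maps, such as states, and not
only homomorphisms. -/
theorem adjoin_le_span {R : Type*} [Ring R] [StarRing R] [Algebra ℂ R] [StarModule ℂ R] {S : Set R}
    (one : 1 ∈ S) (mul : ∀ x ∈ S, ∀ y ∈ S, x * y ∈ S) (star_mem : ∀ x ∈ S, star x ∈ S) {x : R}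
    (hx : x ∈ StarAlgebra.adjoin ℂ S) : x ∈ Submodule.span ℂ S := by
  induction hx using StarAlgebra.adjoin_induction with
  | mem x hx => exact Submodule.subset_span hx
  | algebraMap r =>
    rw [Algebra.algebraMap_eq_smul_one]
    exact Submodule.smul_mem _ _ (Submodule.subset_span one)
  | add x y _ _ hx hy => exact add_mem hx hy
  | mul x y _ _ hx hy =>
    have h := Submodule.mul_mem_mul hx hy
    rw [Submodule.span_mul_span] at h
    refine Submodule.span_mono ?_ h
    rintro _ ⟨x, hx, y, hy, rfl⟩
    exact mul x hx y hy
  | star x hx' hx =>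
    clear hx'
    induction hx using Submodule.span_induction with
    | mem x hx => exact Submodule.subset_span (star_mem x hx)
    | zero => simp
    | add x y _ _ h h' => rw [star_add]; exact add_mem h h'
    | smul r x _ h => rw [star_smul]; exact Submodule.smul_mem _ _ h

/-! ### Families of operators over pairs of states -/

section Fermi

variable {A B : Type*} [CStarAlgebra A] [PartialOrder A] [StarOrderedRing A]
  [CStarAlgebra B] [PartialOrder B] [StarOrderedRing B]
  {α : A ≃⋆ₐ[ℂ] A} {β : B ≃⋆ₐ[ℂ] B}

/-- The bounded operators on `H_ω ⊗ H_φ`. Wrapping the operator type in a definition makes it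
cheap to identify the index `((ω, φ).1, (ω, φ).2)` with `(ω, φ)`. -/
def TensorOp (ω : States A) (φ : States B) : Type _ := HTensor ω.H φ.H →L[ℂ] HTensor ω.H φ.H

instance TensorOp.instCStarAlgebra (ω : States A) (φ : States B) : CStarAlgebra (TensorOp ω φ) :=
  inferInstanceAs (CStarAlgebra (HTensor ω.H φ.H →L[ℂ] HTensor ω.H φ.H))

namespace TensorOp

variable {ω : States A} {φ : States B}

/-- The operator `S ⊗ T`. -/
def of (S : ω.H →L[ℂ] ω.H) (T : φ.H →L[ℂ] φ.H) : TensorOp ω φ := opTensor S T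

theorem of_mul (S S' : ω.H →L[ℂ] ω.H) (T T' : φ.H →L[ℂ] φ.H) :
    of S T * of S' T' = of (S * S') (T * T') := opTensor_mul S S' T T'

theorem star_of (S : ω.H →L[ℂ] ω.H) (T : φ.H →L[ℂ] φ.H) : star (of S T) = of (star S) (star T) :=
  star_opTensor S T

theorem of_one : of (1 : ω.H →L[ℂ] ω.H) (1 : φ.H →L[ℂ] φ.H) = 1 := opTensor_one

theorem of_add_right (S : ω.H →L[ℂ] ω.H) (T T' : φ.H →L[ℂ] φ.H) :
    of S (T + T') = of S T + of S T' := opTensor_add_right S T T'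

variable (ω φ) in
/-- The operator `π_ω(a) ⊗ π_φ(b)`. -/
def tmul (a : A) (b : B) : TensorOp ω φ := of (ω.rep a) (φ.rep b)

end TensorOp

variable (A B) in
/-- The `C*`-algebra `Ambient A B`, with its structure as a `C*`-algebra only. -/
def TensorFamily : Type _ := Ambient A B

instance TensorFamily.instCStarAlgebra : CStarAlgebra (TensorFamily A B) :=
  OpFamily.instCStarAlgebra _

/-- Evaluation of a family of operators at a pair of states. -/
def TensorFamily.eval (p : States A × States B) : TensorFamily A B →⋆ₐ[ℂ] TensorOp p.1 p.2 where
  toFun x := Subtype.val x p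
  map_one' := rfl
  map_mul' _ _ := rfl
  map_zero' := rfl
  map_add' _ _ := rfl
  commutes' _ := rfl
  map_star' _ := rfl

theorem TensorFamily.ext_eval {x y : TensorFamily A B} (h : ∀ p, eval p x = eval p y) : x = y :=
  lp.ext (funext h)

/-- The family of the operators `π_ω(a) ⊗ π_φ(b)` over all pairs of states. -/
def familyTmul (a : A) (b : B) : TensorFamily A B := ambientTmul a b

theorem TensorFamily.eval_familyTmul (p : States A × States B) (a : A) (b : B) :
    eval p (familyTmul a b) = TensorOp.tmul p.1 p.2 a b := rfl

theorem TensorOp.tmul_mul (ω : States A) (φ : States B) (a a' : A) (b b' : B) :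
    tmul ω φ a b * tmul ω φ a' b' = tmul ω φ (a * a') (b * b') := by
  rw [tmul, tmul, tmul, map_mul, map_mul, of_mul]

theorem TensorOp.star_tmul (ω : States A) (φ : States B) (a : A) (b : B) :
    star (tmul ω φ a b) = tmul ω φ (star a) (star b) := by
  rw [tmul, tmul, map_star, map_star, star_of]

theorem TensorOp.tmul_one (ω : States A) (φ : States B) : tmul ω φ 1 1 = 1 := by
  rw [tmul, map_one, map_one, of_one]

theorem TensorOp.tmul_add_right (ω : States A) (φ : States B) (a : A) (b b' : B) :
    tmul ω φ a (b + b') = tmul ω φ a b + tmul ω φ a b' := by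
  rw [tmul, tmul, tmul, map_add, of_add_right]

theorem TensorFamily.tmul_mul (a a' : A) (b b' : B) :
    familyTmul a b * familyTmul a' b' = familyTmul (a * a') (b * b') :=
  ext_eval fun p => by
    rw [map_mul, eval_familyTmul, eval_familyTmul, eval_familyTmul, TensorOp.tmul_mul]

theorem TensorFamily.star_tmul (a : A) (b : B) :
    star (familyTmul a b) = familyTmul (star a) (star b) :=
  ext_eval fun p => by rw [map_star, eval_familyTmul, eval_familyTmul, TensorOp.star_tmul]

theorem TensorFamily.tmul_one : familyTmul (1 : A) (1 : B) = 1 :=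
  ext_eval fun p => by rw [map_one, eval_familyTmul, TensorOp.tmul_one]

theorem TensorFamily.tmul_add_right (a : A) (b b' : B) :
    familyTmul a (b + b') = familyTmul a b + familyTmul a b' :=
  ext_eval fun p => by
    rw [map_add, eval_familyTmul, eval_familyTmul, eval_familyTmul, TensorOp.tmul_add_right]

/-- The representation of families of operators on `H_ω ⊗ H_φ`. -/
def TensorFamily.evalAt (ω : States A) (φ : States B) : TensorFamily A B →⋆ₐ[ℂ] TensorOp ω φ :=
  eval (ω, φ)

theorem TensorFamily.evalAt_tmul (ω : States A) (φ : States B) (a : A) (b : B) :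
    evalAt ω φ (familyTmul a b) = TensorOp.tmul ω φ a b := eval_familyTmul (ω, φ) a b

theorem TensorFamily.ext_evalAt {x y : TensorFamily A B}
    (h : ∀ ω φ, evalAt ω φ x = evalAt ω φ y) : x = y :=
  ext_eval fun p => h p.1 p.2

variable (A B) in
/-- The canonical inclusion of the minimal tensor product. -/
def MinTensor.incl : MinTensor A B →⋆ₐ[ℂ] TensorFamily A B :=
  StarSubalgebra.subtype (closedAdjoin {x : TensorFamily A B | ∃ a b, x = familyTmul a b})

theorem MinTensor.incl_injective : Function.Injective (MinTensor.incl A B) :=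
  Subtype.val_injective

theorem MinTensor.incl_tmul (a : A) (b : B) : MinTensor.incl A B (tmul a b) = familyTmul a b :=
  rfl

theorem tmul_add_right (a : A) (b b' : B) : tmul a (b + b') = tmul a b + tmul a b' :=
  MinTensor.incl_injective (TensorFamily.tmul_add_right a b b')

variable (A B) in
theorem MinTensor.dense_span :
    Dense (Submodule.span ℂ {x : MinTensor A B | ∃ a b, x = tmul a b} : Set (MinTensor A B)) := by
  intro x
  refine closure_subtype.mpr ?_
  refine closure_mono ?_ x.2
  -- The closure is taken in the ambient algebra, so the span there has to be recognised as the
  -- image of the span inside the subalgebra.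
  have h : (Submodule.span ℂ {x : TensorFamily A B | ∃ a b, x = familyTmul a b} :
      Set (TensorFamily A B)) =
      MinTensor.incl A B '' Submodule.span ℂ {x : MinTensor A B | ∃ a b, x = tmul a b} := by
    change _ =
      (Submodule.map (MinTensor.incl A B).toAlgHom.toLinearMap _ : Set (TensorFamily A B))
    rw [Submodule.map_span]
    congr 2
    ext y
    constructor
    · rintro ⟨a, b, rfl⟩
      exact ⟨tmul a b, ⟨a, b, rfl⟩, rfl⟩
    · rintro ⟨_, ⟨a, b, rfl⟩, rfl⟩
      exact ⟨a, b, rfl⟩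
  intro y hy
  refine h.subset (adjoin_le_span ?_ ?_ ?_ hy)
  · exact ⟨1, 1, TensorFamily.tmul_one.symm⟩
  · rintro _ ⟨a, b, rfl⟩ _ ⟨a', b', rfl⟩
    exact ⟨_, _, TensorFamily.tmul_mul a a' b b'⟩
  · rintro _ ⟨a, b, rfl⟩
    exact ⟨_, _, TensorFamily.star_tmul a b⟩

theorem MinTensor.ext_of_tmul {G : Type*} [TopologicalSpace G] [T2Space G] [AddCommMonoid G]
    [Module ℂ G] {f g : MinTensor A B →ₗ[ℂ] G} (hf : Continuous f) (hg : Continuous g)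
    (h : ∀ a b, f (tmul a b) = g (tmul a b)) : f = g := by
  refine DFunLike.coe_injective (hf.ext_on (MinTensor.dense_span A B) hg fun x hx => ?_)
  exact LinearMap.eqOn_span (f := f) (g := g) (by rintro _ ⟨a, b, rfl⟩; exact h a b) hx

theorem MinTensor.induction_on {p : MinTensor A B → Prop} (hp : IsClosed {x | p x})
    (tmul : ∀ a b, p (tmul a b)) (add : ∀ x y, p x → p y → p (x + y))
    (smul : ∀ (c : ℂ) x, p x → p (c • x)) (x : MinTensor A B) : p x := by
  refine (MinTensor.dense_span A B).induction (fun x hx => ?_) hp x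
  induction hx using Submodule.span_induction with
  | mem x hx => obtain ⟨a, b, rfl⟩ := hx; exact tmul a b
  | zero => simpa using smul 0 _ (tmul 0 0)
  | add x y _ _ hx hy => exact add x y hx hy
  | smul c x _ hx => exact smul c x hx


theorem TensorOp.tmul_mul_of_one {ω : States A} {φ : States B} (a : A) (b : B)
    (S : ω.H →L[ℂ] ω.H) : tmul ω φ a b * of S 1 = of (ω.rep a * S) (φ.rep b) := by
  rw [tmul, of_mul, mul_one]

theorem EvenStates.V_mul_rep_mul_V (hα : ∀ a, α (α a) = a) (ω : EvenStates α) (a : A) :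
    ω.V * ω.1.rep a * ω.V = ω.1.rep (α a) := by
  rw [EvenStates.V_mul_rep, mul_assoc, EvenStates.V_mul_V hα, mul_one]

theorem EvenStates.rep_evenPart (hα : ∀ a, α (α a) = a) (ω : EvenStates α) (a : A) :
    ω.1.rep (evenPart α a) = (2⁻¹ : ℂ) • (ω.1.rep a + ω.V * ω.1.rep a * ω.V) := by
  rw [ω.V_mul_rep_mul_V hα, evenPart, map_smul ω.1.rep, map_add ω.1.rep]

theorem EvenStates.rep_oddPart (hα : ∀ a, α (α a) = a) (ω : EvenStates α) (a : A) :
    ω.1.rep (oddPart α a) = (2⁻¹ : ℂ) • (ω.1.rep a - ω.V * ω.1.rep a * ω.V) := by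
  rw [ω.V_mul_rep_mul_V hα, oddPart, map_smul ω.1.rep, map_sub ω.1.rep]

variable (α β) in
/-- The `C*`-algebra `FermiAmbient α β`, with its structure as a `C*`-algebra only. -/
def FermiFamily : Type _ := FermiAmbient α β

namespace FermiFamily

instance instCStarAlgebra : CStarAlgebra (FermiFamily α β) :=
  OpFamily.instCStarAlgebra _

/-- Evaluation of a family of operators at a pair of even states. -/
def eval (p : EvenStates α × EvenStates β) :
    FermiFamily α β →⋆ₐ[ℂ] TensorOp p.1.1 p.2.1 where
  toFun x := Subtype.val x p
  map_one' := rfl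
  map_mul' _ _ := rfl
  map_zero' := rfl
  map_add' _ _ := rfl
  commutes' _ := rfl
  map_star' _ := rfl

theorem ext_eval {x y : FermiFamily α β} (h : ∀ p, eval p x = eval p y) : x = y :=
  lp.ext (funext h)

variable (α β) in
/-- Restriction of a family over all pairs of states to the pairs of even states. -/
def restrict : TensorFamily A B →⋆ₐ[ℂ] FermiFamily α β where
  toFun x := (⟨fun p => TensorFamily.evalAt p.1.1 p.2.1 x, memℓp_infty ⟨‖x‖, by
    rintro _ ⟨p, rfl⟩
    exact NonUnitalStarAlgHom.norm_apply_le (TensorFamily.evalAt p.1.1 p.2.1) x⟩⟩ :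
    FermiAmbient α β)
  map_one' := ext_eval fun p => map_one (TensorFamily.evalAt p.1.1 p.2.1)
  map_mul' x y := ext_eval fun p => map_mul (TensorFamily.evalAt p.1.1 p.2.1) x y
  map_zero' := ext_eval fun p => map_zero (TensorFamily.evalAt p.1.1 p.2.1)
  map_add' x y := ext_eval fun p => map_add (TensorFamily.evalAt p.1.1 p.2.1) x y
  commutes' c := ext_eval fun p => AlgHomClass.commutes (TensorFamily.evalAt p.1.1 p.2.1) c
  map_star' x := ext_eval fun p => map_star (TensorFamily.evalAt p.1.1 p.2.1) x

theorem eval_restrict (p : EvenStates α × EvenStates β) (x : TensorFamily A B) :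
    eval p (restrict α β x) = TensorFamily.evalAt p.1.1 p.2.1 x := rfl

theorem eval_restrict_tmul (p : EvenStates α × EvenStates β) (a : A) (b : B) :
    eval p (restrict α β (familyTmul a b)) = TensorOp.tmul p.1.1 p.2.1 a b := by
  rw [eval_restrict, TensorFamily.evalAt_tmul]

variable (α β) in
/-- The family of the operators `V_ω ⊗ 1`. -/
def gradLeft : FermiFamily α β :=
  (⟨fun p => opTensor p.1.V 1, memℓp_infty ⟨1, by
    rintro _ ⟨p, rfl⟩
    refine (norm_opTensor_le _ _).trans ?_
    simpa using p.1.norm_V_le⟩⟩ : FermiAmbient α β)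

variable (α β) in
/-- The family of the operators `1 ⊗ V_φ`. -/
def gradRight : FermiFamily α β :=
  (⟨fun p => opTensor 1 p.2.V, memℓp_infty ⟨1, by
    rintro _ ⟨p, rfl⟩
    refine (norm_opTensor_le _ _).trans ?_
    simpa using p.2.norm_V_le⟩⟩ : FermiAmbient α β)

theorem eval_gradLeft (p : EvenStates α × EvenStates β) :
    eval p (gradLeft α β) = TensorOp.of p.1.V 1 := rfl

theorem eval_gradRight (p : EvenStates α × EvenStates β) :
    eval p (gradRight α β) = TensorOp.of 1 p.2.V := rfl

theorem gradLeft_sq (hα : ∀ a, α (α a) = a) : gradLeft α β * gradLeft α β = 1 :=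
  ext_eval fun p => by
    rw [map_mul, map_one, eval_gradLeft, TensorOp.of_mul, EvenStates.V_mul_V hα, mul_one,
      TensorOp.of_one]

theorem gradRight_sq (hβ : ∀ b, β (β b) = b) : gradRight α β * gradRight α β = 1 :=
  ext_eval fun p => by
    rw [map_mul, map_one, eval_gradRight, TensorOp.of_mul, EvenStates.V_mul_V hβ, mul_one,
      TensorOp.of_one]

theorem gradRight_mul_gradLeft :
    gradRight α β * gradLeft α β = gradLeft α β * gradRight α β :=
  ext_eval fun p => by
    rw [map_mul, map_mul, eval_gradLeft, eval_gradRight, TensorOp.of_mul, TensorOp.of_mul,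
      one_mul, mul_one, one_mul, mul_one]

theorem star_gradLeft (hα : ∀ a, α (α a) = a) : star (gradLeft α β) = gradLeft α β :=
  ext_eval fun p => by
    rw [map_star, eval_gradLeft, TensorOp.star_of, EvenStates.star_V hα, star_one]

theorem star_gradRight (hβ : ∀ b, β (β b) = b) : star (gradRight α β) = gradRight α β :=
  ext_eval fun p => by
    rw [map_star, eval_gradRight, TensorOp.star_of, EvenStates.star_V hβ, star_one]

theorem gradLeft_mul_restrict_tmul (a : A) (b : B) :
    gradLeft α β * restrict α β (familyTmul a b) =
      restrict α β (familyTmul (α a) b) * gradLeft α β :=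
  ext_eval fun p => by
    rw [map_mul, map_mul, eval_restrict_tmul, eval_restrict_tmul, eval_gradLeft, TensorOp.tmul,
      TensorOp.tmul, TensorOp.of_mul, TensorOp.of_mul, EvenStates.V_mul_rep, one_mul, mul_one]

theorem gradRight_mul_restrict_tmul (a : A) (b : B) :
    gradRight α β * restrict α β (familyTmul a b) =
      restrict α β (familyTmul a (β b)) * gradRight α β :=
  ext_eval fun p => by
    rw [map_mul, map_mul, eval_restrict_tmul, eval_restrict_tmul, eval_gradRight, TensorOp.tmul,
      TensorOp.tmul, TensorOp.of_mul, TensorOp.of_mul, EvenStates.V_mul_rep, one_mul, mul_one]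

variable (α β) in
/-- The family of the Fermi products of `π_ω(a)` and `π_φ(b)`. -/
def fermiTmul (a : A) (b : B) : FermiFamily α β := ambientFmul α β a b

theorem eval_fermiTmul (p : EvenStates α × EvenStates β) (a : A) (b : B) :
    eval p (fermiTmul α β a b) =
      TensorOp.of (p.1.1.rep a) ((2⁻¹ : ℂ) • (p.2.1.rep b + p.2.V * p.2.1.rep b * p.2.V)) +
        TensorOp.of (p.1.1.rep a * p.1.V)
          ((2⁻¹ : ℂ) • (p.2.1.rep b - p.2.V * p.2.1.rep b * p.2.V)) := rfl

/-- Conjugation by `V_φ` implements `β`, so the two halves in `opFermi` are `π_φ(b₊)` and `π_φ(b₋)`.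
The Fermi tensors are thereby expressed through ordinary tensors and `V_ω ⊗ 1` alone. -/
theorem fermiTmul_eq (hβ : ∀ b, β (β b) = b) (a : A) (b : B) :
    fermiTmul α β a b = restrict α β (familyTmul a (evenPart β b)) +
      restrict α β (familyTmul a (oddPart β b)) * gradLeft α β :=
  ext_eval fun p => by
    rw [map_add (eval p), map_mul (eval p), eval_restrict_tmul, eval_restrict_tmul, eval_gradLeft,
      TensorOp.tmul_mul_of_one, TensorOp.tmul]
    exact (eval_fermiTmul p a b).trans
      (congrArg₂ (fun S T => TensorOp.of (p.1.1.rep a) S + TensorOp.of (p.1.1.rep a * p.1.V) T)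
        (p.2.rep_evenPart hβ b).symm (p.2.rep_oddPart hβ b).symm)

end FermiFamily

end Fermi

/-! ### Automatic continuity and averaging of states -/

section States

theorem IsState.continuous {C : Type*} [CStarAlgebra C] {ψ : C →ₗ[ℂ] ℂ} (h : IsState ψ) :
    Continuous ψ := by
  -- Boundedness of positive functionals needs an order on `C`; the spectral order provides one.
  let _ : PartialOrder C := CStarAlgebra.spectralOrder C
  have _ : StarOrderedRing C := CStarAlgebra.spectralOrderedRing C
  obtain ⟨c, hc⟩ := (States.toPositive ⟨ψ, h⟩).exists_norm_apply_le
  exact AddMonoidHomClass.continuous_of_bound ψ c hc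

theorem starAlgHom_continuous {C D : Type*} [CStarAlgebra C] [CStarAlgebra D]
    (f : C →⋆ₐ[ℂ] D) : Continuous f :=
  AddMonoidHomClass.continuous_of_bound f 1 fun x => by
    simpa using NonUnitalStarAlgHom.norm_apply_le f x

theorem IsState.comp {C D : Type*} [Ring C] [StarRing C] [Algebra ℂ C] [Ring D] [StarRing D]
    [Algebra ℂ D] {ψ : D →ₗ[ℂ] ℂ} (h : IsState ψ) (e : C ≃⋆ₐ[ℂ] D) :
    IsState (transpose e ψ) where
  map_one := (congrArg ψ (_root_.map_one e)).trans h.map_one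
  nonneg x := by
    change 0 ≤ ψ (e (star x * x))
    rw [map_mul, map_star]
    exact h.nonneg (e x)

variable {A : Type*} [CStarAlgebra A]

theorem isState_average {ω : A →ₗ[ℂ] ℂ} (h : IsState ω) (α : A ≃⋆ₐ[ℂ] A) :
    IsState ((2⁻¹ : ℂ) • (ω + transpose α ω)) where
  map_one := by
    simp only [LinearMap.smul_apply, LinearMap.add_apply, h.map_one, (h.comp α).map_one,
      smul_eq_mul]
    norm_num
  nonneg x := by
    have : (0 : ℂ) ≤ 2⁻¹ := by norm_num [Complex.le_def]
    exact mul_nonneg this (add_nonneg (h.nonneg x) ((h.comp α).nonneg x))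

variable [PartialOrder A] [StarOrderedRing A] {α : A ≃⋆ₐ[ℂ] A}

/-- The even state `(ω + ω ∘ α) / 2`. -/
def States.average (hα : ∀ a, α (α a) = a) (ω : States A) : EvenStates α :=
  ⟨⟨_, isState_average ω.2 α⟩, fun x => by
    change (2⁻¹ : ℂ) * (ω.1 (α x) + ω.1 (α (α x))) = 2⁻¹ * (ω.1 x + ω.1 (α x))
    rw [hα, add_comm]⟩

/-- As `‖π_ω(x) ξ_ω‖² = ω(x* x)`, domination of `ω` by `c ω'` says that the identity of the algebra
is bounded by `√c` between the two pre-GNS spaces. -/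
theorem States.exists_intertwiner {ω ω' : States A} {c : ℝ} (hc : 0 ≤ c)
    (h : ∀ x, (ω.1 (star x * x)).re ≤ c * (ω'.1 (star x * x)).re) :
    ∃ T : ω'.H →L[ℂ] ω.H, ∀ a, T (ω'.vec a) = ω.vec a := by
  refine ⟨ContinuousLinearMap.completion <| LinearMap.mkContinuous
    (ω.toPositive.toPreGNS.toLinearMap ∘ₗ ω'.toPositive.ofPreGNS.toLinearMap) √c fun x => ?_,
    fun a => ?_⟩
  · rw [PositiveLinearMap.preGNS_norm_def, PositiveLinearMap.preGNS_norm_def, ← Real.sqrt_mul hc]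
    exact Real.sqrt_le_sqrt (h (ω'.toPositive.ofPreGNS x))
  · simp [States.vec]

/-- Positivity of `ω ∘ α` gives `ω ≤ ω + ω ∘ α`, which is twice the average; hence the constant `2`.
-/
theorem States.exists_average_intertwiner (hα : ∀ a, α (α a) = a) (ω : States A) :
    ∃ T : (ω.average hα).1.H →L[ℂ] ω.H, ∀ a, T ((ω.average hα).1.vec a) = ω.vec a := by
  refine States.exists_intertwiner zero_le_two fun x => ?_
  have h : (ω.average hα).1.1 (star x * x) =
    2⁻¹ * (ω.1 (star x * x) + transpose α ω.1 (star x * x)) := rfl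
  have h' : 0 ≤ (transpose α ω.1 (star x * x)).re :=
    (Complex.le_def.mp ((ω.2.comp α).nonneg x)).1
  have h2 : (2⁻¹ : ℂ) = ((2⁻¹ : ℝ) : ℂ) := by norm_num
  rw [h, h2, Complex.re_ofReal_mul, Complex.add_re]
  linarith

end States

/-! ### Faithfulness on even states, and product states -/

section MinTensor

variable {A B : Type*} [CStarAlgebra A] [PartialOrder A] [StarOrderedRing A]
  [CStarAlgebra B] [PartialOrder B] [StarOrderedRing B]

/-- The vector `π_ω(a) ξ_ω ⊗ π_φ(b) ξ_φ`. -/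
def tensorVec (ω : States A) (φ : States B) (a : A) (b : B) : HTensor ω.H φ.H :=
  ((ω.vec a ⊗ₜ[ℂ] φ.vec b : ω.H ⊗[ℂ] φ.H) : HTensor ω.H φ.H)

theorem opTensor_tensorVec (ω : States A) (φ : States B) (a a' : A) (b b' : B) :
    opTensor (ω.rep a) (φ.rep b) (tensorVec ω φ a' b') = tensorVec ω φ (a * a') (b * b') := by
  rw [tensorVec, opTensor_coe_tmul, States.rep_vec, States.rep_vec, tensorVec]

theorem inner_tensorVec (ω : States A) (φ : States B) (a a' : A) (b b' : B) :
    inner ℂ (tensorVec ω φ a b) (tensorVec ω φ a' b') = ω.1 (star a * a') * φ.1 (star b * b') := by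
  simp [tensorVec, States.inner_vec]

theorem ext_tensorVec (ω : States A) (φ : States B) {G : Type*} [NormedAddCommGroup G]
    [NormedSpace ℂ G] {f g : HTensor ω.H φ.H →L[ℂ] G}
    (h : ∀ a b, f (tensorVec ω φ a b) = g (tensorVec ω φ a b)) : f = g := by
  refine HTensor.ext_continuousLinearMap fun x y => ?_
  induction x using ω.denseRange_vec.induction_on with
  | hp => apply isClosed_eq <;> fun_prop
  | ih a =>
    induction y using φ.denseRange_vec.induction_on with
    | hp => apply isClosed_eq <;> fun_prop
    | ih b => exact h a b

/-- The representation `π_ω ⊗ π_φ` of the minimal tensor product. -/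
def MinTensor.rep (ω : States A) (φ : States B) :
    MinTensor A B →⋆ₐ[ℂ] (HTensor ω.H φ.H →L[ℂ] HTensor ω.H φ.H) :=
  ((TensorFamily.evalAt ω φ).comp (MinTensor.incl A B) : MinTensor A B →⋆ₐ[ℂ] TensorOp ω φ)

theorem MinTensor.rep_tmul_tensorVec (ω : States A) (φ : States B) (a a' : A) (b b' : B) :
    MinTensor.rep ω φ (tmul a b) (tensorVec ω φ a' b') = tensorVec ω φ (a * a') (b * b') := by
  rw [← opTensor_tensorVec]
  exact congrArg (fun T : HTensor ω.H φ.H →L[ℂ] HTensor ω.H φ.H => T (tensorVec ω φ a' b'))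
    (TensorFamily.evalAt_tmul ω φ a b)

theorem MinTensor.rep_tensorVec_eq_map {ω ω' : States A} {φ φ' : States B}
    {T : HTensor ω'.H φ'.H →L[ℂ] HTensor ω.H φ.H}
    (hT : ∀ a b, T (tensorVec ω' φ' a b) = tensorVec ω φ a b) (x : MinTensor A B) (a : A) (b : B) :
    MinTensor.rep ω φ x (tensorVec ω φ a b) = T (MinTensor.rep ω' φ' x (tensorVec ω' φ' a b)) := by
  have hc (ω : States A) (φ : States B) : Continuous (MinTensor.rep ω φ) :=
    starAlgHom_continuous (D := HTensor ω.H φ.H →L[ℂ] HTensor ω.H φ.H) _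
  induction x using MinTensor.induction_on with
  | hp =>
    exact isClosed_eq ((hc ω φ).clm_apply continuous_const)
      (T.continuous.comp ((hc ω' φ').clm_apply continuous_const))
  | tmul c d => rw [MinTensor.rep_tmul_tensorVec, MinTensor.rep_tmul_tensorVec, hT]
  | add x y hx hy =>
    rw [map_add, map_add, _root_.add_apply, _root_.add_apply, map_add,
      hx, hy]
  | smul c x hx =>
    rw [map_smul, map_smul, _root_.smul_apply, _root_.smul_apply,
      map_smul, hx]

variable {α : A ≃⋆ₐ[ℂ] A} {β : B ≃⋆ₐ[ℂ] B}

/-- The tensor product of the two averaging intertwiners sends cyclic vectors to cyclic vectors and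
intertwines the representations, so an operator that vanishes upstairs vanishes on a total set
downstairs. -/
theorem MinTensor.rep_eq_zero_of_average (hα : ∀ a, α (α a) = a) (hβ : ∀ b, β (β b) = b)
    {x : MinTensor A B} {ω : States A} {φ : States B}
    (hx : MinTensor.rep (ω.average hα).1 (φ.average hβ).1 x = 0) : MinTensor.rep ω φ x = 0 := by
  obtain ⟨S, hS⟩ := ω.exists_average_intertwiner hα
  obtain ⟨T, hT⟩ := φ.exists_average_intertwiner hβ
  refine ext_tensorVec ω φ fun a b => ?_
  refine (MinTensor.rep_tensorVec_eq_map (T := (TensorProduct.mapL S T).completion)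
    (fun a b => ?_) x a b).trans ?_
  · simp [tensorVec, hS, hT]
  · rw [hx, zero_apply, map_zero, zero_apply]

/-- `x` is in the kernel of `π_ω ⊗ π_φ`. -/
def MinTensor.IsInKer (x : MinTensor A B) (ω : States A) (φ : States B) : Prop :=
  MinTensor.rep ω φ x = 0

theorem MinTensor.isInKer_of_restrict {x : MinTensor A B}
    (hx : FermiFamily.restrict α β (MinTensor.incl A B x) = 0) (ω : EvenStates α)
    (φ : EvenStates β) : x.IsInKer ω.1 φ.1 :=
  have h (p : EvenStates α × EvenStates β) : x.IsInKer p.1.1 p.2.1 :=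
    (congrArg (FermiFamily.eval p) hx).trans (map_zero (FermiFamily.eval p))
  h (ω, φ)

theorem MinTensor.eq_zero_of_isInKer {x : MinTensor A B} (h : ∀ ω φ, x.IsInKer ω φ) : x = 0 :=
  MinTensor.incl_injective <| TensorFamily.ext_evalAt fun ω φ =>
    (h ω φ).trans (map_zero (MinTensor.rep ω φ)).symm

theorem restrict_incl_injective (hα : ∀ a, α (α a) = a) (hβ : ∀ b, β (β b) = b) :
    Function.Injective ((FermiFamily.restrict α β).comp (MinTensor.incl A B)) := by
  refine (injective_iff_map_eq_zero _).mpr fun x hx =>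
    MinTensor.eq_zero_of_isInKer fun ω φ => ?_
  exact MinTensor.rep_eq_zero_of_average hα hβ 
    (MinTensor.isInKer_of_restrict hx _ _)

/-- The product state `a ⊗ b ↦ ω(a) φ(b)`. -/
def States.prod (ω : States A) (φ : States B) : MinTensor A B →ₗ[ℂ] ℂ where
  toFun x := inner ℂ (tensorVec ω φ 1 1) (MinTensor.rep ω φ x (tensorVec ω φ 1 1))
  map_add' x y := by rw [map_add, _root_.add_apply, inner_add_right]
  map_smul' c x := by
    rw [map_smul, _root_.smul_apply, inner_smul_right, smul_eq_mul, RingHom.id_apply]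

theorem States.prod_apply (ω : States A) (φ : States B) (x : MinTensor A B) :
    ω.prod φ x = inner ℂ (tensorVec ω φ 1 1) (MinTensor.rep ω φ x (tensorVec ω φ 1 1)) := rfl

theorem States.isProductStateOf_prod (ω : States A) (φ : States B) :
    IsProductStateOf (tmul (A := A) (B := B)) ω.1 φ.1 (ω.prod φ) where
  left := ω.2
  right := φ.2
  map_elem a b := by
    rw [States.prod_apply, MinTensor.rep_tmul_tensorVec, inner_tensorVec]
    simp
  isState :=
    { map_one := by
        rw [States.prod_apply, map_one, one_apply_eq_self, inner_tensorVec]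
        simp [ω.2.map_one, φ.2.map_one]
      nonneg x := by
        rw [States.prod_apply, map_mul, map_star, ContinuousLinearMap.star_eq_adjoint,
          mul_apply_eq_comp, ContinuousLinearMap.adjoint_inner_right]
        exact RCLike.nonneg_iff.mpr ⟨inner_self_nonneg, inner_self_im _⟩ }

theorem MinTensor.ext_starAlgHom {C : Type*} [CStarAlgebra C] {f g : MinTensor A B →⋆ₐ[ℂ] C}
    (h : ∀ a b, f (tmul a b) = g (tmul a b)) (x : MinTensor A B) : f x = g x :=
  DFunLike.congr_fun (MinTensor.ext_of_tmul (f := f.toAlgHom.toLinearMap)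
    (g := g.toAlgHom.toLinearMap) (starAlgHom_continuous f) (starAlgHom_continuous g) h) x

theorem MinTensor.ext_isState {ψ χ : MinTensor A B →ₗ[ℂ] ℂ} (hψ : IsState ψ) (hχ : IsState χ)
    (h : ∀ a b, ψ (tmul a b) = χ (tmul a b)) : ψ = χ :=
  MinTensor.ext_of_tmul hψ.continuous hχ.continuous h

end MinTensor

/-! ### The Klein unitary, algebraically -/

section Graded

variable {A B X : Type*} [Ring A] [StarRing A] [Algebra ℂ A] [Ring B] [StarRing B] [Algebra ℂ B]
  [Ring X] [StarRing X]

/-- `t` is a multiplicative system of elementary tensors and `g`, `w` are commuting selfadjoint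
unitaries which implement the gradings `α` and `β` on the two factors. -/
structure IsGradedTensor (α : A ≃⋆ₐ[ℂ] A) (β : B ≃⋆ₐ[ℂ] B) (t : A → B → X) (g w : X) : Prop where
  map_one : t 1 1 = 1
  map_mul : ∀ a a' b b', t a b * t a' b' = t (a * a') (b * b')
  map_star : ∀ a b, star (t a b) = t (star a) (star b)
  map_neg_right : ∀ a b, t a (-b) = -t a b
  left_sq : g * g = 1
  right_sq : w * w = 1
  comm : w * g = g * w
  star_left : star g = g
  star_right : star w = w
  left_mul : ∀ a b, g * t a b = t (α a) b * g
  right_mul : ∀ a b, w * t a b = t a (β b) * w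

namespace IsGradedTensor

variable {α : A ≃⋆ₐ[ℂ] A} {β : B ≃⋆ₐ[ℂ] B} {t : A → B → X} {g w : X} {u : A}

/-- The unitary implementing the Klein transformation. -/
def kleinUnitary [Algebra ℂ X] (t : A → B → X) (g w : X) (u : A) : X := twist (t u 1 * g) w

theorem map_unit (hα : ∀ a, α a = u * a * u) (hu : u * u = 1) : α u = u := by
  rw [hα, hu, one_mul]

theorem inner_sq (ht : IsGradedTensor α β t g w) (hα : ∀ a, α a = u * a * u) (hu : u * u = 1) :
    t u 1 * g * (t u 1 * g) = 1 := by
  rw [mul_assoc, ← mul_assoc g, ht.left_mul, mul_assoc, ht.left_sq, mul_one, ht.map_mul,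
    map_unit hα hu, hu, one_mul, ht.map_one]

theorem right_mul_inner (ht : IsGradedTensor α β t g w) :
    w * (t u 1 * g) = t u 1 * g * w := by
  rw [← mul_assoc, ht.right_mul, _root_.map_one, mul_assoc, ht.comm, mul_assoc]

theorem star_inner (ht : IsGradedTensor α β t g w) (hα : ∀ a, α a = u * a * u) (hu : u * u = 1)
    (hu' : star u = u) : star (t u 1 * g) = t u 1 * g := by
  rw [star_mul, ht.star_left, ht.map_star, hu', star_one, ht.left_mul, map_unit hα hu]

/-- Both `u` and `g` implement `α` on the left factor, and `u² = 1`, so the two actions cancel in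
the product. -/
theorem inner_mul (ht : IsGradedTensor α β t g w) (hα : ∀ a, α a = u * a * u) (hu : u * u = 1)
    (a : A) (b : B) : t u 1 * g * t a b = t a b * (t u 1 * g) := by
  rw [mul_assoc, ht.left_mul, ← mul_assoc, ht.map_mul, ← mul_assoc, ht.map_mul, one_mul, mul_one,
    hα, ← mul_assoc, ← mul_assoc, hu, one_mul]

theorem star_kleinUnitary [Algebra ℂ X] [StarModule ℂ X]
    (ht : IsGradedTensor α β t g w) (hα : ∀ a, α a = u * a * u)
    (hu : u * u = 1) (hu' : star u = u) :
    star (kleinUnitary t g w u) = kleinUnitary t g w u :=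
  star_twist (ht.star_inner hα hu hu') ht.star_right ht.right_mul_inner

theorem kleinUnitary_mem [Algebra ℂ X] [StarModule ℂ X]
    (ht : IsGradedTensor α β t g w) (hα : ∀ a, α a = u * a * u)
    (hu : u * u = 1) (hu' : star u = u) : kleinUnitary t g w u ∈ unitary X := by
  have h' : kleinUnitary t g w u * kleinUnitary t g w u = 1 :=
    twist_mul_twist (ht.inner_sq hα hu) ht.right_sq ht.right_mul_inner
  rw [Unitary.mem_iff, ht.star_kleinUnitary hα hu hu']
  exact ⟨h', h'⟩

/-- Conjugation by the Klein unitary turns `a ⊗ b₊ + a u ⊗ b₋` into the Fermi tensor. -/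
theorem kleinUnitary_conj [Algebra ℂ X] [StarModule ℂ X]
    (ht : IsGradedTensor α β t g w) (hα : ∀ a, α a = u * a * u)
    (hβ : ∀ b, β (β b) = b) (hu : u * u = 1) (hu' : star u = u) (a : A) (b : B) :
    kleinUnitary t g w u * (t a (evenPart β b) + t (a * u) (oddPart β b)) *
        star (kleinUnitary t g w u) =
      t a (evenPart β b) + t a (oddPart β b) * g := by
  -- The even summand commutes with `w` and is fixed. The odd one anticommutes with `w` and acquires
  -- the factor `u g`, where `a u u = a` leaves only `g`.
  rw [ht.star_kleinUnitary hα hu hu', mul_add, add_mul, kleinUnitary,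
    twist_mul_mul_twist_of_commute (ht.inner_sq hα hu) ht.right_sq ht.right_mul_inner
      (ht.inner_mul hα hu _ _) (by rw [ht.right_mul, map_evenPart hβ]),
    twist_mul_mul_twist_of_anticommute (ht.inner_sq hα hu) ht.right_sq ht.right_mul_inner
      (ht.inner_mul hα hu _ _)
      (by rw [ht.right_mul, map_oddPart hβ, ht.map_neg_right, neg_mul]),
    ← mul_assoc, ht.map_mul, mul_assoc a, hu, mul_one, mul_one]

theorem grading_mem (ht : IsGradedTensor α β t g w) : g * w ∈ unitary X := by
  have h : star (g * w) = g * w := by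
    rw [star_mul, ht.star_left, ht.star_right, ht.comm]
  have h' : g * w * (g * w) = 1 := by
    rw [mul_assoc, ← mul_assoc w, ht.comm, mul_assoc, ht.right_sq, mul_one, ht.left_sq]
  rw [Unitary.mem_iff, h]
  exact ⟨h', h'⟩

/-- The unitary `g w` implements `α` and `β` simultaneously and commutes with `g`, so it respects
the Fermi form of the tensors. -/
theorem grading_conj (ht : IsGradedTensor α β t g w) (a : A) (b : B) :
    g * w * (t a (evenPart β b) + t a (oddPart β b) * g) * star (g * w) =
      t (α a) (evenPart β (β b)) + t (α a) (oddPart β (β b)) * g := by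
  have h (a b) : g * w * t a b = t (α a) (β b) * (g * w) := by
    rw [mul_assoc, ht.right_mul, ← mul_assoc, ht.left_mul, mul_assoc]
  have h' : g * w * g = g * (g * w) := by rw [mul_assoc, ht.comm]
  have h'' : g * w * star (g * w) = 1 := Unitary.mul_star_self_of_mem ht.grading_mem
  rw [mul_add, add_mul, ← mul_assoc (g * w) (t a _) g, h, h, mul_assoc _ (g * w) g, h',
    mul_assoc _ (g * w), h'', mul_one, mul_assoc, mul_assoc g, h'', mul_one, evenPart_map,
    oddPart_map]

theorem grading_kleinUnitary_conj [Algebra ℂ X] [StarModule ℂ X]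
    (ht : IsGradedTensor α β t g w) (hα : ∀ a, α a = u * a * u)
    (hβ : ∀ b, β (β b) = b) (hu : u * u = 1) (hu' : star u = u) (a : A) (b : B) :
    g * w * kleinUnitary t g w u * (t a (evenPart β b) + t (a * u) (oddPart β b)) *
        star (g * w * kleinUnitary t g w u) =
      t (α a) (evenPart β (β b)) + t (α a) (oddPart β (β b)) * g := by
  rw [← ht.grading_conj, ← ht.kleinUnitary_conj hα hβ hu hu' a b, star_mul (g * w)]
  simp only [mul_assoc]

end IsGradedTensor

end Graded

/-! ### Isomorphism from equality of images -/

section Lift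

/-- The isomorphism of `closedAdjoin S` with a `C*`-algebra embedded in the same ambient algebra
with the same image. -/
theorem exists_closedAdjoin_equiv {M X : Type*} [CStarAlgebra M] [CStarAlgebra X] {S : Set X}
    (f : M →⋆ₐ[ℂ] X) (hf : Function.Injective f) (hS : S ⊆ Set.range f)
    (hfS : ∀ x, f x ∈ closedAdjoin S) :
    ∃ e : closedAdjoin S ≃⋆ₐ[ℂ] M, ∀ y, f (e y) = y := by
  -- An injective `*`-homomorphism is isometric, so its range is closed and contains `closedAdjoin
  -- S` as soon as it contains `S`.
  have hclosed : IsClosed (f.range : Set X) :=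
    (NonUnitalStarAlgHom.isometry f hf).isClosedEmbedding.isClosed_range
  have hle : closedAdjoin S ≤ f.range :=
    StarSubalgebra.topologicalClosure_minimal (StarAlgebra.adjoin_le hS) hclosed
  have hb : Function.Bijective (f.codRestrict (closedAdjoin S) hfS) :=
    ⟨fun x y h => hf (congrArg Subtype.val h), fun y => by
      obtain ⟨x, hx⟩ := hle y.2
      exact ⟨x, Subtype.ext hx⟩⟩
  refine ⟨(StarAlgEquiv.ofBijective _ hb).symm, fun y => ?_⟩
  exact congrArg Subtype.val ((StarAlgEquiv.ofBijective _ hb).apply_symm_apply y)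

end Lift

/-! ### The Klein isomorphism, gradings and product states -/

section Klein

variable {A B : Type*} [CStarAlgebra A] [PartialOrder A] [StarOrderedRing A]
  [CStarAlgebra B] [PartialOrder B] [StarOrderedRing B]
  {α : A ≃⋆ₐ[ℂ] A} {β : B ≃⋆ₐ[ℂ] B} {u : A}

theorem tmul_zero_right (a : A) : tmul a (0 : B) = 0 := by
  simpa using tmul_add_right a (0 : B) 0

theorem tmul_neg_right (a : A) (b : B) : tmul a (-b) = -tmul a b :=
  eq_neg_of_add_eq_zero_left (by rw [← tmul_add_right, neg_add_cancel, tmul_zero_right])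

theorem isGradedTensor_restrict (hα : ∀ a, α (α a) = a) (hβ : ∀ b, β (β b) = b) :
    IsGradedTensor α β (fun a b => FermiFamily.restrict α β (MinTensor.incl A B (tmul a b)))
      (FermiFamily.gradLeft α β) (FermiFamily.gradRight α β) where
  map_one := by rw [MinTensor.incl_tmul, TensorFamily.tmul_one, map_one]
  map_mul a a' b b' := by
    rw [MinTensor.incl_tmul, MinTensor.incl_tmul, MinTensor.incl_tmul, ← TensorFamily.tmul_mul,
      map_mul]
  map_star a b := by
    rw [MinTensor.incl_tmul, MinTensor.incl_tmul, ← TensorFamily.star_tmul, map_star]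
  map_neg_right a b := by rw [tmul_neg_right, map_neg, map_neg]
  left_sq := FermiFamily.gradLeft_sq hα
  right_sq := FermiFamily.gradRight_sq hβ
  comm := FermiFamily.gradRight_mul_gradLeft
  star_left := FermiFamily.star_gradLeft hα
  star_right := FermiFamily.star_gradRight hβ
  left_mul := FermiFamily.gradLeft_mul_restrict_tmul
  right_mul := FermiFamily.gradRight_mul_restrict_tmul

/-- The element `a ⊗ b₊ + a u ⊗ b₋`. -/
def kleinTmul (β : B ≃⋆ₐ[ℂ] B) (u a : A) (b : B) : MinTensor A B :=
  tmul a (evenPart β b) + tmul (a * u) (oddPart β b)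

/-- For odd `b` the factor `u` is cancelled by starting from `a u`, since `u² = 1`. Thus the Klein
images span all elementary tensors, which gives surjectivity and the formula for `κ⁻¹`. -/
theorem tmul_eq_kleinTmul (hβ : ∀ b, β (β b) = b) (hu : u * u = 1) (a : A) (b : B) :
    tmul a b = kleinTmul β u a (evenPart β b) + kleinTmul β u (a * u) (oddPart β b) := by
  rw [kleinTmul, kleinTmul, evenPart_evenPart hβ, oddPart_evenPart hβ, evenPart_oddPart hβ,
    oddPart_oddPart hβ, tmul_zero_right, mul_assoc, hu, mul_one, add_zero,
    zero_add, ← tmul_add_right, evenPart_add_oddPart]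

/-- Conjugating `r` by `v` gives a second embedding, whose image is the algebra generated by the `m
a b`. The reparametrisations `γ`, `δ` allow two uses: identities yield `κ`, while `α` and `β` yield
`κ` composed with the inverse grading. -/
theorem exists_equiv_of_unitary {X : Type*} [CStarAlgebra X] (r : MinTensor A B →⋆ₐ[ℂ] X)
    (hr : Function.Injective r) (hβ : ∀ b, β (β b) = b) (hu : u * u = 1) (m : A → B → X)
    {γ : A → A} {δ : B → B} (hγ : Function.Surjective γ) (hδ : Function.Surjective δ)
    (v : unitary X)
    (hv : ∀ a b, v * (r (tmul a (evenPart β b)) + r (tmul (a * u) (oddPart β b))) *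
      star (v : X) = m (γ a) (δ b)) :
    ∃ e : closedAdjoin {x : X | ∃ a b, x = m a b} ≃⋆ₐ[ℂ] MinTensor A B,
      ∀ a b, e ⟨m (γ a) (δ b), subset_closedAdjoin _ ⟨_, _, rfl⟩⟩ = kleinTmul β u a b := by
  let f : MinTensor A B →⋆ₐ[ℂ] X := (Unitary.conjStarAlgAut ℂ X v : X →⋆ₐ[ℂ] X).comp r
  have hf : Function.Injective f := (Unitary.conjStarAlgAut ℂ X v).injective.comp hr
  have hfk (a b) : f (kleinTmul β u a b) = m (γ a) (δ b) := by
    rw [← hv, ← map_add]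
    rfl
  have hft (x) : f x ∈ closedAdjoin {x : X | ∃ a b, x = m a b} := by
    have hmem (a b) : f (kleinTmul β u a b) ∈ closedAdjoin {x : X | ∃ a b, x = m a b} :=
      subset_closedAdjoin _ ⟨_, _, hfk a b⟩
    induction x using MinTensor.induction_on with
    | hp =>
      exact (StarSubalgebra.isClosed_topologicalClosure _).preimage (starAlgHom_continuous f)
    | tmul a b =>
      rw [tmul_eq_kleinTmul hβ hu, map_add]
      exact add_mem (hmem _ _) (hmem _ _)
    | add x y hx hy => rw [map_add]; exact add_mem hx hy
    | smul c x hx => rw [map_smul]; exact SMulMemClass.smul_mem c hx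
  obtain ⟨e, he⟩ := exists_closedAdjoin_equiv f hf (by
    rintro _ ⟨a, b, rfl⟩
    obtain ⟨a, rfl⟩ := hγ a
    obtain ⟨b, rfl⟩ := hδ b
    exact ⟨_, hfk a b⟩) hft
  exact ⟨e, fun a b => hf ((he _).trans (hfk a b).symm)⟩

theorem exists_klein (hα : ∀ a, α a = u * a * u) (hα' : ∀ a, α (α a) = a)
    (hβ : ∀ b, β (β b) = b) (hu : u * u = 1) (hu' : star u = u) :
    ∃ κ : FermiTensor α β ≃⋆ₐ[ℂ] MinTensor A B, IsKlein α β u κ := by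
  have ht := isGradedTensor_restrict hα' hβ
  refine exists_equiv_of_unitary _ (restrict_incl_injective hα' hβ) hβ hu
    (FermiFamily.fermiTmul α β) Function.surjective_id Function.surjective_id
    ⟨_, ht.kleinUnitary_mem hα hu hu'⟩ fun a b => ?_
  exact (ht.kleinUnitary_conj hα hβ hu hu' a b).trans (FermiFamily.fermiTmul_eq hβ a b).symm

theorem exists_klein_grading (hα : ∀ a, α a = u * a * u) (hα' : ∀ a, α (α a) = a)
    (hβ : ∀ b, β (β b) = b) (hu : u * u = 1) (hu' : star u = u) :
    ∃ e : FermiTensor α β ≃⋆ₐ[ℂ] MinTensor A B,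
      ∀ a b, e (fmul α β (α a) (β b)) = kleinTmul β u a b := by
  have ht := isGradedTensor_restrict hα' hβ
  refine exists_equiv_of_unitary _ (restrict_incl_injective hα' hβ) hβ hu
    (FermiFamily.fermiTmul α β) α.surjective β.surjective
    ⟨_, mul_mem ht.grading_mem (ht.kleinUnitary_mem hα hu hu')⟩ fun a b => ?_
  exact (ht.grading_kleinUnitary_conj hα hβ hu hu' a b).trans
    (FermiFamily.fermiTmul_eq hβ _ _).symm

variable {κ : FermiTensor α β ≃⋆ₐ[ℂ] MinTensor A B}

theorem IsKlein.symm_kleinTmul (hκ : IsKlein α β u κ) (a : A) (b : B) :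
    κ.symm (kleinTmul β u a b) = fmul α β a b := by
  rw [kleinTmul, ← hκ, StarAlgEquiv.symm_apply_apply]

theorem IsKlein.symm_tmul (hκ : IsKlein α β u κ) (hβ : ∀ b, β (β b) = b) (hu : u * u = 1)
    (a : A) (b : B) :
    κ.symm (tmul a b) = fmul α β a (evenPart β b) + fmul α β (a * u) (oddPart β b) := by
  rw [tmul_eq_kleinTmul hβ hu, map_add, hκ.symm_kleinTmul, hκ.symm_kleinTmul]

/-- Each `κ⁻¹(a ⊗ b)` is a sum of two elementary Fermi tensors, so the density known for `A ⊗ B` is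
transported along `κ`. -/
theorem IsKlein.ext_starAlgHom (hκ : IsKlein α β u κ) (hβ : ∀ b, β (β b) = b) (hu : u * u = 1)
    {C : Type*} [CStarAlgebra C] {f g : FermiTensor α β →⋆ₐ[ℂ] C}
    (h : ∀ a b, f (fmul α β a b) = g (fmul α β a b)) (x : FermiTensor α β) : f x = g x := by
  have := MinTensor.ext_starAlgHom (f := f.comp (κ.symm : _ →⋆ₐ[ℂ] _))
    (g := g.comp (κ.symm : _ →⋆ₐ[ℂ] _)) (fun a b => by
      change f (κ.symm _) = g (κ.symm _)
      rw [hκ.symm_tmul hβ hu, map_add, map_add, h, h]) (κ x)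
  change f (κ.symm (κ x)) = g (κ.symm (κ x)) at this
  rwa [StarAlgEquiv.symm_apply_apply] at this

theorem IsKlein.ext_starAlgEquiv (hκ : IsKlein α β u κ) (hβ : ∀ b, β (β b) = b) (hu : u * u = 1)
    {C : Type*} [CStarAlgebra C] {f g : FermiTensor α β ≃⋆ₐ[ℂ] C}
    (h : ∀ a b, f (fmul α β a b) = g (fmul α β a b)) : f = g :=
  StarAlgEquiv.ext fun x =>
    hκ.ext_starAlgHom hβ hu (f := (f : FermiTensor α β →⋆ₐ[ℂ] C))
      (g := (g : FermiTensor α β →⋆ₐ[ℂ] C)) h x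

theorem MinTensor.ext_starAlgEquiv {C : Type*} [CStarAlgebra C] {f g : MinTensor A B ≃⋆ₐ[ℂ] C}
    (h : ∀ a b, f (tmul a b) = g (tmul a b)) : f = g :=
  StarAlgEquiv.ext fun x =>
    MinTensor.ext_starAlgHom (f := (f : MinTensor A B →⋆ₐ[ℂ] C))
      (g := (g : MinTensor A B →⋆ₐ[ℂ] C)) h x

theorem IsKlein.isProductStateOf_transpose (hκ : IsKlein α β u κ) {ω : A →ₗ[ℂ] ℂ}
    {φ : B →ₗ[ℂ] ℂ} (hφ : IsEven β φ) {ψ : MinTensor A B →ₗ[ℂ] ℂ}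
    (h : IsProductStateOf tmul ω φ ψ) : IsProductStateOf (fmul α β) ω φ (transpose κ ψ) where
  left := h.left
  right := h.right
  isState := h.isState.comp κ
  map_elem a b := by
    change ψ (κ _) = _
    -- The term `ω(a u) φ(b₋)` is zero and may be exchanged for `ω(a) φ(b₋)`, also zero, after which
    -- `b₊` and `b₋` recombine.
    rw [hκ, map_add, h.map_elem, h.map_elem, hφ.map_oddPart, mul_zero, ← mul_zero (ω a),
      ← hφ.map_oddPart b, ← mul_add, ← map_add, evenPart_add_oddPart]

theorem IsKlein.isProductStateOf_transpose_symm (hκ : IsKlein α β u κ) (hβ : ∀ b, β (β b) = b)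
    (hu : u * u = 1) {ω : A →ₗ[ℂ] ℂ} {φ : B →ₗ[ℂ] ℂ} (hφ : IsEven β φ)
    {χ : FermiTensor α β →ₗ[ℂ] ℂ} (h : IsProductStateOf (fmul α β) ω φ χ) :
    IsProductStateOf tmul ω φ (transpose κ.symm χ) where
  left := h.left
  right := h.right
  isState := h.isState.comp κ.symm
  map_elem a b := by
    change χ (κ.symm _) = _
    rw [hκ.symm_tmul hβ hu, map_add, h.map_elem, h.map_elem, hφ.map_oddPart, mul_zero,
      ← mul_zero (ω a), ← hφ.map_oddPart b, ← mul_add, ← map_add, evenPart_add_oddPart]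

theorem transpose_transpose_symm (χ : FermiTensor α β →ₗ[ℂ] ℂ) :
    transpose κ (transpose κ.symm χ) = χ :=
  LinearMap.ext fun x => congrArg χ (κ.symm_apply_apply x)

theorem transpose_injective : Function.Injective (transpose κ) := fun ψ χ h =>
  LinearMap.ext fun x => by
    have := LinearMap.congr_fun h (κ.symm x)
    change ψ (κ (κ.symm x)) = χ (κ (κ.symm x)) at this
    rwa [StarAlgEquiv.apply_symm_apply] at this

theorem IsProductStateOf.ext_tmul {ω : A →ₗ[ℂ] ℂ} {φ : B →ₗ[ℂ] ℂ}
    {ψ ψ' : MinTensor A B →ₗ[ℂ] ℂ} (h : IsProductStateOf tmul ω φ ψ)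
    (h' : IsProductStateOf tmul ω φ ψ') : ψ = ψ' :=
  MinTensor.ext_isState h.isState h'.isState fun a b => by rw [h.map_elem, h'.map_elem]

theorem IsKlein.ext_isProductStateOf (hκ : IsKlein α β u κ) (hβ : ∀ b, β (β b) = b)
    (hu : u * u = 1) {ω : A →ₗ[ℂ] ℂ} {φ : B →ₗ[ℂ] ℂ} (hφ : IsEven β φ)
    {χ χ' : FermiTensor α β →ₗ[ℂ] ℂ} (h : IsProductStateOf (fmul α β) ω φ χ)
    (h' : IsProductStateOf (fmul α β) ω φ χ') : χ = χ' := by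
  rw [← transpose_transpose_symm (κ := κ) χ, ← transpose_transpose_symm (κ := κ) χ',
    (hκ.isProductStateOf_transpose_symm hβ hu hφ h).ext_tmul
      (hκ.isProductStateOf_transpose_symm hβ hu hφ h')]

/-- Because `ω(1) = 1`, the right marginal is `b ↦ ψ(m 1 b)`; as `α` fixes `1`, it inherits the
invariance of `ψ`. -/
theorem IsProductStateOf.isEven_right {A B C : Type*} [Ring A] [StarRing A] [Algebra ℂ A] [Ring B]
    [StarRing B] [Algebra ℂ B] [Ring C] [StarRing C] [Algebra ℂ C] {m : A → B → C}
    {α : A ≃⋆ₐ[ℂ] A} {β : B ≃⋆ₐ[ℂ] B} {θ : C ≃⋆ₐ[ℂ] C} (hθ : IsProductGrading m α β θ)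
    {ω : A →ₗ[ℂ] ℂ} {φ : B →ₗ[ℂ] ℂ} {ψ : C →ₗ[ℂ] ℂ} (h : IsProductStateOf m ω φ ψ)
    (hψ : IsEven θ ψ) : IsEven β φ := fun b => by
  have h1 (b) : ψ (m 1 b) = φ b := by rw [h.map_elem, h.left.map_one, one_mul]
  rw [← h1, ← h1, ← hψ (m 1 b), hθ, map_one]

/-- The element `u` is even, so the factor `a u` goes to `α(a) u`, and both composites agree on
elementary Fermi tensors. -/
theorem IsKlein.map_grading (hκ : IsKlein α β u κ) (hβ : ∀ b, β (β b) = b) (hu : u * u = 1)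
    (hαu : α u = u) {θF : FermiTensor α β ≃⋆ₐ[ℂ] FermiTensor α β}
    {θX : MinTensor A B ≃⋆ₐ[ℂ] MinTensor A B} (hθF : IsProductGrading (fmul α β) α β θF)
    (hθX : IsProductGrading tmul α β θX) (x : FermiTensor α β) : κ (θF x) = θX (κ x) := by
  refine DFunLike.congr_fun (hκ.ext_starAlgEquiv hβ hu (f := θF.trans κ) (g := κ.trans θX)
    fun a b => ?_) x
  rw [StarAlgEquiv.trans_apply, StarAlgEquiv.trans_apply, hθF, hκ, hκ, map_add, hθX, hθX,
    map_mul, hαu, evenPart_map, oddPart_map]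

/-- Existence of the grading on `A ⊗ B` is obtained by transport from the Fermi side. -/
theorem IsKlein.isProductGrading_tmul (hκ : IsKlein α β u κ) (hβ : ∀ b, β (β b) = b)
    (hu : u * u = 1) (hαu : α u = u) {θF : FermiTensor α β ≃⋆ₐ[ℂ] FermiTensor α β}
    (hθF : IsProductGrading (fmul α β) α β θF) :
    IsProductGrading tmul α β (κ.symm.trans (θF.trans κ)) := fun a b => by
  rw [StarAlgEquiv.trans_apply, StarAlgEquiv.trans_apply, hκ.symm_tmul hβ hu, map_add, map_add,
    hθF, hθF, hκ, hκ, map_mul, hαu, ← evenPart_map, ← oddPart_map]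
  exact (tmul_eq_kleinTmul hβ hu _ _).symm

theorem IsKlein.bijOn_transpose (hκ : IsKlein α β u κ) (hβ : ∀ b, β (β b) = b) (hu : u * u = 1)
    (hαu : α u = u) {θF : FermiTensor α β ≃⋆ₐ[ℂ] FermiTensor α β}
    {θX : MinTensor A B ≃⋆ₐ[ℂ] MinTensor A B} (hθF : IsProductGrading (fmul α β) α β θF)
    (hθX : IsProductGrading tmul α β θX) :
    Set.BijOn (transpose κ) (evenProductStates tmul θX) (evenProductStates (fmul α β) θF) := by
  have hθ := hκ.map_grading hβ hu hαu hθF hθX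
  refine ⟨?_, transpose_injective.injOn, ?_⟩
  · rintro ψ ⟨hψ, ω, φ, h⟩
    refine ⟨fun x => ?_, ω, φ, hκ.isProductStateOf_transpose (h.isEven_right hθX hψ) h⟩
    change ψ (κ (θF x)) = ψ (κ x)
    rw [hθ, hψ]
  · rintro χ ⟨hχ, ω, φ, h⟩
    refine ⟨transpose κ.symm χ, ⟨fun x => ?_, ω, φ,
      hκ.isProductStateOf_transpose_symm hβ hu (h.isEven_right hθF hχ) h⟩,
      transpose_transpose_symm χ⟩
    change χ (κ.symm (θX x)) = χ (κ.symm x)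
    rw [← hχ (κ.symm x), ← κ.symm_apply_apply (θF (κ.symm x)), hθ, κ.apply_symm_apply]

end Klein

end KleinFermi

end

/-! ### The main theorem -/

open KleinFermi in
theorem theorem3p3 {A B : Type*}
    [CStarAlgebra A] [PartialOrder A] [StarOrderedRing A]
    [CStarAlgebra B] [PartialOrder B] [StarOrderedRing B]
    (α : A ≃⋆ₐ[ℂ] A) (β : B ≃⋆ₐ[ℂ] B) (hβ : ∀ b, β (β b) = b)
    (u : A) (hu : u ∈ unitary A) (hu' : IsSelfAdjoint u) (hα : ∀ a, α a = u * a * star u) :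
    (∃! θF : FermiTensor α β ≃⋆ₐ[ℂ] FermiTensor α β, IsProductGrading (fmul α β) α β θF) ∧
    (∃! θX : MinTensor A B ≃⋆ₐ[ℂ] MinTensor A B, IsProductGrading tmul α β θX) ∧
    (∃! κ : FermiTensor α β ≃⋆ₐ[ℂ] MinTensor A B, IsKlein α β u κ) ∧
    (∀ (ω : A →ₗ[ℂ] ℂ) (φ : B →ₗ[ℂ] ℂ), IsState ω → IsEven α ω → IsState φ → IsEven β φ →
      (∃! ψ, IsProductStateOf (tmul (A := A) (B := B)) ω φ ψ) ∧
      (∃! χ, IsProductStateOf (fmul α β) ω φ χ)) ∧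
    ∀ (θF : FermiTensor α β ≃⋆ₐ[ℂ] FermiTensor α β) (θX : MinTensor A B ≃⋆ₐ[ℂ] MinTensor A B)
      (κ : FermiTensor α β ≃⋆ₐ[ℂ] MinTensor A B),
      IsProductGrading (fmul α β) α β θF → IsProductGrading tmul α β θX → IsKlein α β u κ →
      (∀ x, κ (θF x) = θX (κ x)) ∧
      Set.BijOn (transpose κ) (evenProductStates tmul θX)
        (evenProductStates (fmul α β) θF) ∧
      ∀ (ω : A →ₗ[ℂ] ℂ) (φ : B →ₗ[ℂ] ℂ), IsEven α ω → IsEven β φ →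
        ∀ ψ, IsProductStateOf tmul ω φ ψ → IsProductStateOf (fmul α β) ω φ (transpose κ ψ) := by
  have hu2 : u * u = 1 := by
    simpa only [hu'.star_eq] using Unitary.star_mul_self_of_mem hu
  have hα1 : ∀ a, α a = u * a * u := fun a => by rw [hα, hu'.star_eq]
  have hα2 : ∀ a, α (α a) = a := fun a => by
    rw [hα1, hα1, ← mul_assoc, ← mul_assoc, hu2, one_mul, mul_assoc, hu2, mul_one]
  have hαu : α u = u := IsGradedTensor.map_unit hα1 hu2
  obtain ⟨κ, hκ⟩ := exists_klein hα1 hα2 hβ hu2 hu'.star_eq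
  obtain ⟨e, he⟩ := exists_klein_grading hα1 hα2 hβ hu2 hu'.star_eq
  -- Both `κ` at `(a, b)` and `e` at `(α a, β b)` take the value `a ⊗ b₊ + a u ⊗ b₋`, so `e⁻¹ ∘ κ`
  -- is the grading.
  have hθ : IsProductGrading (fmul α β) α β (κ.trans e.symm) := fun a b => by
    rw [StarAlgEquiv.trans_apply, hκ, ← kleinTmul, ← he, StarAlgEquiv.symm_apply_apply]
  refine ⟨⟨_, hθ, fun θ h => ?_⟩, ⟨_, hκ.isProductGrading_tmul hβ hu2 hαu hθ, fun θ h => ?_⟩,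
    ⟨κ, hκ, fun κ' h => ?_⟩, fun ω φ hω _ hφ hφ' => ?_, fun θF θX κ hθF hθX hκ =>
    ⟨hκ.map_grading hβ hu2 hαu hθF hθX, hκ.bijOn_transpose hβ hu2 hαu hθF hθX,
      fun ω φ _ hφ ψ h => hκ.isProductStateOf_transpose hφ h⟩⟩
  · exact hκ.ext_starAlgEquiv hβ hu2 fun a b => (h a b).trans (hθ a b).symm
  · exact MinTensor.ext_starAlgEquiv fun a b =>
      (h a b).trans (hκ.isProductGrading_tmul hβ hu2 hαu hθ a b).symm
  · exact hκ.ext_starAlgEquiv hβ hu2 fun a b => (h a b).trans (hκ a b).symm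
  -- On `A ⊗ B` the state is the vector state of `ξ_ω ⊗ ξ_φ`; on the Fermi side it is the pullback
  -- of that state along `κ`.
  · have hψ := States.isProductStateOf_prod (⟨ω, hω⟩ : States A) (⟨φ, hφ⟩ : States B)
    exact ⟨⟨_, hψ, fun ψ h => h.ext_tmul hψ⟩, ⟨_, hκ.isProductStateOf_transpose hφ' hψ,
      fun χ h => hκ.ext_isProductStateOf hβ hu2 hφ' h (hκ.isProductStateOf_transpose hφ' hψ)⟩⟩
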